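/- Let $F(\mathbb C)$ be the complex manifold of complete flags $0=E_0\subset E_1\subset\cdots\subset E_n=\mathbb C^n$ ($\dim E_m=m$), with its tautological filtration $0=E_0\subset E_1\subset\cdots\subset E_n=E$ of the trivial bundle $E=F(\mathbb C)\times\mathbb C^n$. Give $E$ the trivial hermitian metric (the standard one on $\mathbb C^n$), each $E_l$ the restricted metric, and each $E_l/E_k$ ($0\le k<l\le n$) the induced quotient metric; in particular $\overline L_k=\overline{E_k/E_{k-1}}$. For each of these hermitian holomorphic vector bundles let $K=D^2$ be the curvature of its hermitian holomorphic (Chern) connection $D$. Let $p:SU(n)\to F(\mathbb C)$ send $g$ to the flag whose $m$-th space is spanned by the first $m$ columns $g_1,\dots,g_m$ of $g$; forms on $F(\mathbb C)$ are identified with their pullbacks by $p$. For $i>j$ let $\omega^{ij}$ and $\overline\omega^{ij}$ be the left invariant complex $1$-forms on $SU(n)$ whose values on the left invariant vector field $X\in\mathfrak{su}(n)$ are $\omega^{ij}(X)=X_{ij}$ and $\overline\omega^{ij}(X)=-X_{ji}=\overline{X_{ij}}$. Wedge products are normalized by $(\varphi\wedge\psi)(X,Y)=\varphi(X)\psi(Y)-\varphi(Y)\psi(X)$.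 (1) Let $0\le k<l\le n$. The bundle $E_l/E_k$ has a holomorphic frame near every point, and the matrix $\Theta=(\Theta_{\alpha\beta})_{k+1\le\alpha,\beta\le l}$ of its curvature in the unitary frame $([g_{k+1}],\dots,[g_l])$, with the convention $K[g_\alpha]=\sum_\beta\Theta_{\alpha\beta}\,[g_\beta]$, is $$\Theta_{\alpha\beta}=\sum_{i\le k}\omega^{\beta i}\wedge\overline\omega^{\alpha i}-\sum_{j>l}\omega^{j\alpha}\wedge\overline\omega^{j\beta}.$$ (2) Let $\gamma\in\mathbb C$ satisfy $\gamma^2=\frac{i}{2\pi}$, and for $i<j$ put $\omega_{ij}=\gamma\,\omega^{ji}$, $\overline\omega_{ij}=\gamma\,\overline\omega^{ji}$ and $\Omega_{ij}=\omega_{ij}\wedge\overline\omega_{ij}$. Then for $1\le k\le n$ the first Chern form $c_1(\overline L_k)=\operatorname{Tr}\bigl(\frac{i}{2\pi}K(\overline L_k)\bigr)$ is $$c_1(\overline L_k)=\sum_{i<k}\Omega_{ik}-\sum_{j>k}\Omega_{kj},$$ and the matrix $K_{\overline E_k}=\frac{i}{2\pi}K(\overline E_k)$, in the frame $(g_1,\dots,g_k)$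 and with the same convention, is $$K_{\overline E_k}=-\Bigl\{\sum_{j>k}\omega_{\alpha j}\wedge\overline\omega_{\beta j}\Bigr\}_{1\le\alpha,\beta\le k}.$$ -/

import Mathlib

open scoped Manifold ContDiff Matrix

/-- A complete flag `0 = E_0 ⊂ E_1 ⊂ ⋯ ⊂ E_n = ℂⁿ`, with `dim E_m = m`, in `ℂⁿ` with its standard
hermitian inner product. -/
@[ext]
structure CompleteFlag (n : ℕ) where
  sub : Fin (n + 1) → Submodule ℂ (EuclideanSpace ℂ (Fin n))
  mono : Monotone sub
  finrank_sub : ∀ m, Module.finrank ℂ (sub m) = m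

namespace CompleteFlag

variable {n : ℕ}

/-- The `j`-th column of an invertible matrix. -/
def col (A : GL (Fin n) ℂ) (j : Fin n) : EuclideanSpace ℂ (Fin n) :=
  WithLp.toLp 2 (fun i => A.1 i j)

lemma inv_mulVec_col (A B : GL (Fin n) ℂ) (i j : Fin n) :
    ((A⁻¹).1 *ᵥ (col B j).ofLp) i = (A⁻¹ * B).1 i j := by
  simp [col, Matrix.mulVec, dotProduct, Matrix.mul_apply]

/-- `v ↦ A v` as a linear equivalence. -/
noncomputable def colEquiv (A : GL (Fin n) ℂ) : (Fin n → ℂ) ≃ₗ[ℂ] EuclideanSpace ℂ (Fin n) where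
  toFun v := WithLp.toLp 2 (A.1 *ᵥ v)
  map_add' v w := by rw [Matrix.mulVec_add]; rfl
  map_smul' c v := by rw [Matrix.mulVec_smul]; rfl
  invFun v := (A⁻¹).1 *ᵥ v.ofLp
  left_inv v := by simp [Matrix.mulVec_mulVec]
  right_inv v := by
    have : A.1 * (A⁻¹).1 = 1 := by rw [← Units.val_mul]; simp
    simp [Matrix.mulVec_mulVec, -Matrix.coe_units_inv, this]

/-- The columns of `A` as a basis. -/
noncomputable def colBasis (A : GL (Fin n) ℂ) : Module.Basis (Fin n) ℂ (EuclideanSpace ℂ (Fin n)) :=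
  (Pi.basisFun ℂ (Fin n)).map (colEquiv A)

lemma colBasis_apply (A : GL (Fin n) ℂ) (j : Fin n) : colBasis A j = col A j := by
  simp [colBasis, colEquiv, col, Matrix.col]
  rfl

lemma colBasis_repr (A : GL (Fin n) ℂ) (v : EuclideanSpace ℂ (Fin n)) (i : Fin n) :
    (colBasis A).repr v i = ((A⁻¹).1 *ᵥ v.ofLp) i := by
  simp only [colBasis, colEquiv, Module.Basis.map_repr, LinearEquiv.trans_apply, Pi.basisFun_repr]
  rfl

/-- The span of the first `m` columns of `A`. -/
def colSpan (A : GL (Fin n) ℂ) (m : Fin (n + 1)) : Submodule ℂ (EuclideanSpace ℂ (Fin n)) :=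
  Submodule.span ℂ (col A '' {j | j.castSucc < m})

lemma mem_colSpan (A : GL (Fin n) ℂ) (m : Fin (n + 1)) (v : EuclideanSpace ℂ (Fin n)) :
    v ∈ colSpan A m ↔ ∀ i : Fin n, m ≤ i.castSucc → ((A⁻¹).1 *ᵥ v.ofLp) i = 0 := by
  have h : col A = colBasis A := funext fun j => (colBasis_apply A j).symm
  rw [colSpan, h, Module.Basis.mem_span_image]
  constructor
  · intro hs i hi
    rw [← colBasis_repr]
    by_contra hne
    have := hs (Finsupp.mem_support_iff.2 hne)
    exact absurd hi (not_le.2 this)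
  · intro hs i hi
    by_contra hlt
    have := hs i (not_lt.1 hlt)
    rw [← colBasis_repr] at this
    exact (Finsupp.mem_support_iff.1 hi) this

lemma linearIndependent_col (A : GL (Fin n) ℂ) : LinearIndependent ℂ (col A) := by
  have h : col A = colBasis A := funext fun j => (colBasis_apply A j).symm
  rw [h]; exact (colBasis A).linearIndependent

/-- The projection `GL_n(ℂ) → F(ℂ)`: the `m`-th space of the flag of `A` is spanned by the first `m`
columns of `A`. -/
def ofGL (A : GL (Fin n) ℂ) : CompleteFlag n where
  sub := colSpan A
  mono m m' h := Submodule.span_mono (Set.image_mono fun _ hj => lt_of_lt_of_le hj h)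
  finrank_sub m := by
    have hli : LinearIndependent ℂ (fun j : {j : Fin n // j.castSucc < m} => col A j) :=
      (linearIndependent_col A).comp _ Subtype.val_injective
    have := finrank_span_eq_card hli
    have hr : Set.range (fun j : {j : Fin n // j.castSucc < m} => col A j)
        = col A '' {j | j.castSucc < m} := by
      rw [Set.image_eq_range]; rfl
    rw [hr] at this
    rw [colSpan, this, Fintype.card_subtype]
    have : (Finset.univ.filter fun j : Fin n => j.castSucc < m).map Fin.valEmbedding
        = Finset.range m := by
      ext a
      simp only [Finset.mem_map, Finset.mem_filter, Finset.mem_univ, true_and, Finset.mem_range,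
        Fin.lt_def, Fin.val_castSucc, Fin.valEmbedding_apply]
      constructor
      · rintro ⟨b, hb, rfl⟩; exact hb
      · intro ha; exact ⟨⟨a, by omega⟩, ha, rfl⟩
    rw [← Finset.card_map Fin.valEmbedding, this, Finset.card_range]

lemma eq_of_le {F G : CompleteFlag n} (h : ∀ m, F.sub m ≤ G.sub m) : F = G := by
  ext1
  funext m
  exact Submodule.eq_of_le_of_finrank_eq (h m) (by rw [F.finrank_sub, G.finrank_sub])

lemma upper_of_ofGL_eq {A B : GL (Fin n) ℂ} (h : ofGL A = ofGL B) {i j : Fin n} (hij : j < i) :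
    (A⁻¹ * B).1 i j = 0 := by
  have h1 : col B j ∈ colSpan A j.succ := by
    have : colSpan A = colSpan B := congrArg sub h
    rw [this]
    exact Submodule.subset_span ⟨j, Fin.castSucc_lt_succ, rfl⟩
  rw [← inv_mulVec_col]
  exact (mem_colSpan A _ _).1 h1 i (Fin.succ_le_castSucc_iff.2 hij)

lemma ofGL_eq_of_upper {A B : GL (Fin n) ℂ}
    (h : ∀ i j : Fin n, j < i → (A⁻¹ * B).1 i j = 0) : ofGL A = ofGL B := by
  symm
  apply eq_of_le
  intro m
  apply Submodule.span_le.2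
  rintro _ ⟨j, hj, rfl⟩
  refine (mem_colSpan A m _).2 fun i hi => ?_
  rw [inv_mulVec_col]
  exact h i j (Fin.castSucc_lt_castSucc_iff.1 (lt_of_lt_of_le hj hi))

lemma exists_ofGL (F : CompleteFlag n) : ∃ A : GL (Fin n) ℂ, ofGL A = F := by
  have hex : ∀ j : Fin n, ∃ v, v ∈ F.sub j.succ ∧ v ∉ F.sub j.castSucc := by
    intro j
    by_contra! hc
    have h1 := Submodule.finrank_mono (show F.sub j.succ ≤ F.sub j.castSucc from hc)
    rw [F.finrank_sub, F.finrank_sub] at h1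
    simp at h1
  choose v hv hv' using hex
  have hli : LinearIndependent ℂ v := by
    rw [Fintype.linearIndependent_iff]
    intro c hc
    by_contra! hne
    obtain ⟨i₀, hi₀⟩ := hne
    have hS : (Finset.univ.filter fun i => c i ≠ 0).Nonempty := ⟨i₀, by simpa using hi₀⟩
    set j := (Finset.univ.filter fun i => c i ≠ 0).max' hS with hj
    have hcj : c j ≠ 0 := by
      have := Finset.max'_mem _ hS
      simpa using this
    have hgt : ∀ i, j < i → c i = 0 := by
      intro i hi
      by_contra h0
      have := Finset.le_max' (Finset.univ.filter fun i => c i ≠ 0) i (by simpa using h0)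
      exact absurd hi (not_lt.2 this)
    rw [← Finset.add_sum_erase _ _ (Finset.mem_univ j)] at hc
    have hmem : ∑ i ∈ Finset.univ.erase j, c i • v i ∈ F.sub j.castSucc := by
      apply Submodule.sum_mem
      intro i hi
      rcases lt_trichotomy i j with h | h | h
      · exact Submodule.smul_mem _ _ (F.mono (Fin.succ_le_castSucc_iff.2 h) (hv i))
      · exact absurd h (Finset.ne_of_mem_erase hi)
      · rw [hgt i h, zero_smul]; exact Submodule.zero_mem _
    have h2 : c j • v j ∈ F.sub j.castSucc := by
      rw [eq_neg_of_add_eq_zero_left hc]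
      exact Submodule.neg_mem _ hmem
    exact hv' j ((Submodule.smul_mem_iff _ hcj).1 h2)
  let M : Matrix (Fin n) (Fin n) ℂ := Matrix.of fun i j => (v j).ofLp i
  have hM : IsUnit M := by
    rw [← Matrix.linearIndependent_cols_iff_isUnit]
    have := hli.map' (WithLp.linearEquiv 2 ℂ (Fin n → ℂ)).toLinearMap (LinearEquiv.ker _)
    exact this
  refine ⟨hM.unit, eq_of_le fun m => Submodule.span_le.2 ?_⟩
  rintro _ ⟨j, hj, rfl⟩
  exact F.mono (Fin.castSucc_lt_iff_succ_le.1 hj) (hv j)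


/-! ### The complex manifold structure

The standard affine charts of the flag manifold: for `A` in `GL_n(ℂ)`, the lower unitriangular
matrices `U` are mapped bijectively to an open set of flags by `U ↦ (flag of A U)`. -/

/-- The model space of the flag manifold: strictly lower triangular matrices. -/
abbrev Model (n : ℕ) : Type := {p : Fin n × Fin n // p.2 < p.1} → ℂ

/-- The lower unitriangular matrix with given entries below the diagonal. -/
def lowerUni (L : Model n) : Matrix (Fin n) (Fin n) ℂ :=
  Matrix.of fun i j => if h : j < i then L ⟨(i, j), h⟩ else if i = j then 1 else 0

lemma lowerUni_lower (L : Model n) : (lowerUni L).BlockTriangular OrderDual.toDual := by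
  intro i j hij
  have hij : i < j := hij
  simp [lowerUni, not_lt.2 hij.le, hij.ne]

lemma lowerUni_diag (L : Model n) (i : Fin n) : lowerUni L i i = 1 := by simp [lowerUni]

lemma det_lowerUni (L : Model n) : (lowerUni L).det = 1 := by
  rw [Matrix.det_of_isLowerTriangular _ (lowerUni_lower L)]
  simp [lowerUni_diag]

/-- `lowerUni L` as an invertible matrix. -/
noncomputable def lowerUniGL (L : Model n) : GL (Fin n) ℂ :=
  Matrix.GeneralLinearGroup.mkOfDetNeZero (lowerUni L) (by rw [det_lowerUni]; exact one_ne_zero)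

lemma coe_lowerUniGL (L : Model n) : (lowerUniGL L).1 = lowerUni L := rfl

lemma lowerUni_injective : Function.Injective (lowerUni (n := n)) := by
  intro L L' h
  funext ⟨⟨i, j⟩, hij⟩
  have := congrFun (congrFun h i) j
  have hij' : j < i := hij
  simpa [lowerUni, hij'] using this

lemma lowerUniGL_zero : lowerUniGL (0 : Model n) = 1 := by
  ext i j
  rw [coe_lowerUniGL]
  by_cases h : i = j <;> simp [lowerUni, h]

/-- The affine parametrization centred at the flag of `A`. -/
noncomputable def param (A : GL (Fin n) ℂ) (L : Model n) : CompleteFlag n :=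
  ofGL (A * lowerUniGL L)

lemma param_injective (A : GL (Fin n) ℂ) : Function.Injective (param A) := by
  intro L L' h
  have hup : ∀ i j : Fin n, j < i → ((lowerUniGL L)⁻¹ * lowerUniGL L').1 i j = 0 := by
    intro i j hij
    have := upper_of_ofGL_eq h hij
    simpa [mul_assoc] using this
  set C := (lowerUniGL L)⁻¹ * lowerUniGL L' with hC
  have hlow : C.1.BlockTriangular OrderDual.toDual := by
    rw [hC, Units.val_mul, Matrix.coe_units_inv]
    refine Matrix.BlockTriangular.mul ?_ (lowerUni_lower L')
    have : Invertible (lowerUniGL L).1 := (lowerUniGL L).invertible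
    exact Matrix.blockTriangular_inv_of_blockTriangular (lowerUni_lower L)
  have hprod : lowerUni L' = lowerUni L * C.1 := by
    have : lowerUniGL L' = lowerUniGL L * C := by rw [hC]; simp
    exact congrArg Units.val this
  have hoff : ∀ i j : Fin n, i ≠ j → C.1 i j = 0 := by
    intro i j hij
    rcases lt_or_gt_of_ne hij with h1 | h1
    · exact hlow h1
    · exact hup i j h1
  have hdiag : ∀ i, C.1 i i = 1 := by
    intro i
    have h1 := congrFun (congrFun hprod i) i
    rw [Matrix.mul_apply, Finset.sum_eq_single i (fun b _ hb => by rw [hoff b i hb, mul_zero])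
      (by simp), lowerUni_diag, lowerUni_diag, one_mul] at h1
    exact h1.symm
  have hone : C.1 = 1 := by
    ext i j
    by_cases hij : i = j
    · subst hij; rw [hdiag, Matrix.one_apply_eq]
    · rw [hoff i j hij, Matrix.one_apply_ne hij]
  rw [hone, mul_one] at hprod
  exact (lowerUni_injective hprod).symm

/-- The affine chart centred at the flag of `A`, the inverse of `param A`. -/
noncomputable def chart (A : GL (Fin n) ℂ) : PartialEquiv (CompleteFlag n) (Model n) where
  toFun := Function.invFun (param A)
  invFun := param A
  source := Set.range (param A)
  target := Set.univ
  map_source' _ _ := Set.mem_univ _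
  map_target' L _ := ⟨L, rfl⟩
  left_inv' _ h := Function.invFun_eq h
  right_inv' L _ := Function.leftInverse_invFun (param_injective A) L

/-- The leading principal block of `M` with last index `b`. -/
def lead (M : Matrix (Fin n) (Fin n) ℂ) (b : Fin n) :
    Matrix {i : Fin n // i ≤ b} {i : Fin n // i ≤ b} ℂ :=
  M.submatrix Subtype.val Subtype.val

/-- The upper triangular matrix `C` for which `M * C` is lower unitriangular (if there is one). -/
noncomputable def corr (M : Matrix (Fin n) (Fin n) ℂ) : Matrix (Fin n) (Fin n) ℂ :=
  Matrix.of fun c b => if h : c ≤ b then (lead M b)⁻¹ ⟨c, h⟩ ⟨b, le_rfl⟩ else 0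

/-- The entries below the diagonal of the lower unitriangular factor of `M`. -/
noncomputable def lowerPart (M : Matrix (Fin n) (Fin n) ℂ) : Model n :=
  fun p => (M * corr M) p.1.1 p.1.2

lemma sum_le_eq (b : Fin n) (f : Fin n → ℂ) (hf : ∀ c, ¬ c ≤ b → f c = 0) :
    ∑ c, f c = ∑ c : {i : Fin n // i ≤ b}, f c := by
  rw [← Finset.sum_subtype (Finset.univ.filter fun c => c ≤ b) (by simp) f]
  symm
  apply Finset.sum_subset (Finset.filter_subset _ _)
  intro c _ hc
  exact hf c (by simpa using hc)

lemma mul_corr_apply (M : Matrix (Fin n) (Fin n) ℂ) (i b : Fin n) :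
    (M * corr M) i b = ∑ c : {i : Fin n // i ≤ b}, M i c * (lead M b)⁻¹ c ⟨b, le_rfl⟩ := by
  rw [Matrix.mul_apply, sum_le_eq b _ (fun c hc => by simp [corr, hc])]
  refine Finset.sum_congr rfl fun c _ => ?_
  simp [corr, c.2]

lemma mul_corr {M : Matrix (Fin n) (Fin n) ℂ} (hM : ∀ b, (lead M b).det ≠ 0) :
    M * corr M = lowerUni (lowerPart M) := by
  ext i b
  by_cases h : b < i
  · simp [lowerUni, h, lowerPart]
  · have hib : i ≤ b := not_lt.1 h
    rw [mul_corr_apply]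
    have h1 : lead M b * (lead M b)⁻¹ = 1 :=
      Matrix.mul_nonsing_inv _ (isUnit_iff_ne_zero.2 (hM b))
    have h2 := congrFun (congrFun h1 ⟨i, hib⟩) ⟨b, le_rfl⟩
    rw [Matrix.mul_apply] at h2
    refine h2.trans ?_
    simp [lowerUni, h, Matrix.one_apply]

lemma lead_mul {P C : Matrix (Fin n) (Fin n) ℂ} (hC : ∀ i j : Fin n, j < i → C i j = 0)
    (b : Fin n) : lead (P * C) b = lead P b * lead C b := by
  ext i j
  rw [lead, Matrix.submatrix_apply, Matrix.mul_apply, sum_le_eq b, Matrix.mul_apply]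
  · rfl
  · intro c hc
    rw [hC c j (lt_of_le_of_lt j.2 (not_le.1 hc)), mul_zero]

lemma param_lowerPart (A B : GL (Fin n) ℂ) (h : ∀ b, (lead (A⁻¹ * B).1 b).det ≠ 0) :
    param A (lowerPart (A⁻¹ * B).1) = ofGL B := by
  symm
  apply ofGL_eq_of_upper
  intro i j hij
  have h1 := mul_corr h
  have h2 : (B⁻¹ * (A * lowerUniGL (lowerPart (A⁻¹ * B).1))).1 = corr (A⁻¹ * B).1 := by
    rw [Units.val_mul, Units.val_mul, coe_lowerUniGL, ← h1, Units.val_mul, ← mul_assoc,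
      ← mul_assoc, ← mul_assoc, ← Units.val_mul, ← Units.val_mul, ← Units.val_mul]
    simp
  rw [h2]
  simp [corr, not_le.2 hij]

lemma lead_one (b : Fin n) : lead (1 : Matrix (Fin n) (Fin n) ℂ) b = 1 :=
  Matrix.submatrix_one _ Subtype.val_injective

lemma det_lead_lowerUni (L : Model n) (b : Fin n) : (lead (lowerUni L) b).det = 1 := by
  have h : (lead (lowerUni L) b).BlockTriangular OrderDual.toDual :=
    fun i j hij => lowerUni_lower L (i := i.1) (j := j.1) hij
  rw [Matrix.det_of_isLowerTriangular _ h]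
  simp [lead, lowerUni_diag]

lemma ofGL_mem_range_iff (A B : GL (Fin n) ℂ) :
    ofGL B ∈ Set.range (param A) ↔ ∀ b, (lead (A⁻¹ * B).1 b).det ≠ 0 := by
  constructor
  · rintro ⟨L, hL⟩ b
    set C := (A * lowerUniGL L)⁻¹ * B with hC
    have hup : ∀ i j : Fin n, j < i → C.1 i j = 0 := fun i j hij => upper_of_ofGL_eq hL hij
    have h1 : lead C⁻¹.1 b * lead C.1 b = 1 := by
      rw [← lead_mul hup, ← Units.val_mul, inv_mul_cancel, Units.val_one, lead_one]
    have h2 : (A⁻¹ * B).1 = lowerUni L * C.1 := by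
      rw [← coe_lowerUniGL, ← Units.val_mul, hC]
      congr 1
      group
    rw [h2, lead_mul hup, Matrix.det_mul, det_lead_lowerUni, one_mul]
    intro h0
    have := congrArg Matrix.det h1
    rw [Matrix.det_mul, h0, mul_zero, Matrix.det_one] at this
    exact zero_ne_one this
  · intro h
    exact ⟨_, param_lowerPart A B h⟩

lemma contDiff_det {E m : Type*} [NormedAddCommGroup E] [NormedSpace ℂ E] [Fintype m]
    [DecidableEq m] {f : E → Matrix m m ℂ} (h : ∀ i j, ContDiff ℂ ω fun x => f x i j) :
    ContDiff ℂ ω fun x => (f x).det := by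
  simp only [Matrix.det_apply]
  exact ContDiff.sum fun σ _ => (contDiff_prod fun i _ => h _ _).const_smul _

lemma contDiff_adjugate {E m : Type*} [NormedAddCommGroup E] [NormedSpace ℂ E] [Fintype m]
    [DecidableEq m] {f : E → Matrix m m ℂ} (h : ∀ i j, ContDiff ℂ ω fun x => f x i j) (i j : m) :
    ContDiff ℂ ω fun x => (f x).adjugate i j := by
  simp only [Matrix.adjugate_apply]
  refine contDiff_det fun a b => ?_
  simp only [Matrix.updateRow_apply]
  split_ifs
  · exact contDiff_const
  · exact h a b

/-- The matrix comparing two affine charts. -/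
noncomputable def compare (A A' : GL (Fin n) ℂ) (L : Model n) : Matrix (Fin n) (Fin n) ℂ :=
  (A'⁻¹ * (A * lowerUniGL L)).1

lemma contDiff_compare (A A' : GL (Fin n) ℂ) (i j : Fin n) :
    ContDiff ℂ ω fun L : Model n => compare A A' L i j := by
  have : ∀ L : Model n, compare A A' L = (A'⁻¹ * A).1 * lowerUni L := by
    intro L
    rw [compare, ← mul_assoc, Units.val_mul (A'⁻¹ * A), coe_lowerUniGL]
  simp only [this, Matrix.mul_apply]
  refine ContDiff.sum fun c _ => contDiff_const.mul ?_
  simp only [lowerUni, Matrix.of_apply]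
  split_ifs
  · exact contDiff_apply ℂ ℂ _
  · exact contDiff_const
  · exact contDiff_const

lemma contDiff_det_lead (A A' : GL (Fin n) ℂ) (b : Fin n) :
    ContDiff ℂ ω fun L : Model n => (lead (compare A A' L) b).det :=
  contDiff_det fun i j => contDiff_compare A A' i j

lemma transition_source (A A' : GL (Fin n) ℂ) :
    ((chart A).symm.trans (chart A')).source =
      {L | ∀ b, (lead (compare A A' L) b).det ≠ 0} := by
  ext L
  rw [PartialEquiv.trans_source]
  change L ∈ Set.univ ∩ _ ↔ _
  rw [Set.univ_inter]
  exact ofGL_mem_range_iff A' (A * lowerUniGL L)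

lemma contDiffOn_transition (A A' : GL (Fin n) ℂ) :
    ContDiffOn ℂ ω ((chart A).symm.trans (chart A')) ((chart A).symm.trans (chart A')).source := by
  rw [transition_source]
  have key : Set.EqOn ((chart A).symm.trans (chart A')) (fun L => lowerPart (compare A A' L))
      {L | ∀ b, (lead (compare A A' L) b).det ≠ 0} := by
    intro L hL
    change Function.invFun (param A') (param A L) = _
    rw [show param A L = param A' (lowerPart (compare A A' L)) from
      (param_lowerPart A' (A * lowerUniGL L) hL).symm]
    exact Function.leftInverse_invFun (param_injective A') _
  refine ContDiffOn.congr ?_ key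
  rw [contDiffOn_pi]
  intro p
  simp only [lowerPart, mul_corr_apply, Matrix.inv_def, Ring.inverse_eq_inv', Matrix.smul_apply,
    smul_eq_mul]
  refine ContDiffOn.sum fun c _ => (contDiff_compare A A' _ _).contDiffOn.mul (ContDiffOn.mul ?_ ?_)
  · exact (contDiff_det_lead A A' _).contDiffOn.inv fun L hL => hL _
  · exact (contDiff_adjugate (f := fun L => lead (compare A A' L) p.1.2)
      (fun i j => contDiff_compare A A' i j) _ _).contDiffOn

lemma isOpen_transition_source (A A' : GL (Fin n) ℂ) :
    IsOpen ((chart A).symm.trans (chart A')).source := by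
  rw [transition_source, Set.ofPred_forall]
  exact isOpen_iInter_of_finite fun b =>
    isOpen_ne_fun (contDiff_det_lead A A' b).continuous continuous_const

/-- The atlas of all affine charts. -/
noncomputable def chartedSpaceCore (n : ℕ) : ChartedSpaceCore (Model n) (CompleteFlag n) where
  atlas := Set.range chart
  chartAt F := chart (exists_ofGL F).choose
  mem_chart_source F := ⟨0, by
    rw [param, lowerUniGL_zero, mul_one]; exact (exists_ofGL F).choose_spec⟩
  chart_mem_atlas _ := ⟨_, rfl⟩
  open_source := by
    rintro _ _ ⟨A, rfl⟩ ⟨A', rfl⟩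
    exact isOpen_transition_source A A'
  continuousOn_toFun := by
    rintro _ _ ⟨A, rfl⟩ ⟨A', rfl⟩
    exact (contDiffOn_transition A A').continuousOn

noncomputable instance instTopologicalSpace : TopologicalSpace (CompleteFlag n) :=
  (chartedSpaceCore n).toTopologicalSpace

noncomputable instance instChartedSpace : ChartedSpace (Model n) (CompleteFlag n) :=
  (chartedSpaceCore n).toChartedSpace

instance instIsManifold : IsManifold 𝓘(ℂ, Model n) ω (CompleteFlag n) := by
  apply isManifold_of_contDiffOn
  intro e e' he he'
  have he : e ∈ ⋃ (f : _) (hf : f ∈ (chartedSpaceCore n).atlas),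
    {(chartedSpaceCore n).openPartialHomeomorph f hf} := he
  have he' : e' ∈ ⋃ (f : _) (hf : f ∈ (chartedSpaceCore n).atlas),
    {(chartedSpaceCore n).openPartialHomeomorph f hf} := he'
  simp only [Set.mem_iUnion, Set.mem_singleton_iff] at he he'
  obtain ⟨_, ⟨A, rfl⟩, rfl⟩ := he
  obtain ⟨_, ⟨A', rfl⟩, rfl⟩ := he'
  have h := contDiffOn_transition A A'
  simp only [modelWithCornersSelf_coe, modelWithCornersSelf_coe_symm, Set.range_id,
    Set.inter_univ, Set.preimage_id, Function.id_comp, Function.comp_id]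
  exact h

/-! ### The bundles `E_l / E_k` with their induced metrics -/

/-- The (zero-based) indices `k ≤ a < l`; in one-based numbering these are `k + 1, …, l`. -/
abbrev BlockIdx (k l : Fin (n + 1)) : Type := {a : Fin n // k ≤ a.castSucc ∧ a.castSucc < l}

/-- The fibre `E_l / E_k` of the tautological quotient bundle at the flag `F`. -/
abbrev QuotFiber (F : CompleteFlag n) (k l : Fin (n + 1)) : Type :=
  ↥(F.sub l) ⧸ (F.sub k).submoduleOf (F.sub l)

/-- The orthogonal splitting `E_l / E_k → ℂⁿ`: a class is mapped to its representative that is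
orthogonal to `E_k`. -/
noncomputable def splitting (F : CompleteFlag n) (k l : Fin (n + 1)) :
    QuotFiber F k l →ₗ[ℂ] EuclideanSpace ℂ (Fin n) :=
  Submodule.liftQ _ ((F.sub k)ᗮ.starProjection.toLinearMap ∘ₗ (F.sub l).subtype) (by
    intro v hv
    rw [LinearMap.mem_ker]
    change (F.sub k)ᗮ.starProjection (v : EuclideanSpace ℂ (Fin n)) = 0
    rw [Submodule.starProjection_apply_eq_zero_iff]
    exact Submodule.le_orthogonal_orthogonal _ hv)

/-- The hermitian metric on `E_l / E_k` induced by the standard metric of `ℂⁿ` (restricted to `E_l`,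
then passed to the quotient); linear in the first argument. -/
noncomputable def quotMetric (F : CompleteFlag n) (k l : Fin (n + 1)) (a b : QuotFiber F k l) : ℂ :=
  inner ℂ (splitting F k l b) (splitting F k l a)

lemma mem_colSpan_repr (A : GL (Fin n) ℂ) (m : Fin (n + 1)) (v : EuclideanSpace ℂ (Fin n)) :
    v ∈ colSpan A m ↔ ∀ i : Fin n, m ≤ i.castSucc → (colBasis A).repr v i = 0 := by
  simp only [mem_colSpan, colBasis_repr]

/-- The class in `E_l / E_k` of the `a`-th column of `A`, where `E_•` is the flag of `A`. -/
noncomputable def colClass (A : GL (Fin n) ℂ) (k l : Fin (n + 1)) (a : BlockIdx k l) :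
    QuotFiber (ofGL A) k l :=
  Submodule.Quotient.mk ⟨col A a, Submodule.subset_span ⟨a, a.2.2, rfl⟩⟩

lemma sum_repr (A : GL (Fin n) ℂ) (k l : Fin (n + 1)) (c : BlockIdx k l → ℂ) (i : Fin n) :
    (colBasis A).repr (∑ a, c a • col A a.1) i =
      if h : k ≤ i.castSucc ∧ i.castSucc < l then c ⟨i, h⟩ else 0 := by
  simp only [← colBasis_apply, map_sum, map_smul, Module.Basis.repr_self, Finsupp.coe_finsetSum,
    Finset.sum_apply, Finsupp.smul_apply, Finsupp.single_apply, smul_eq_mul, mul_ite, mul_one,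
    mul_zero]
  split_ifs with h
  · rw [Finset.sum_eq_single ⟨i, h⟩]
    · simp
    · intro b _ hb
      rw [if_neg]
      intro hbi
      exact hb (Subtype.ext hbi)
    · simp
  · refine Finset.sum_eq_zero fun b _ => if_neg ?_
    rintro rfl
    exact h b.2

lemma linearIndependent_colClass (A : GL (Fin n) ℂ) (k l : Fin (n + 1)) :
    LinearIndependent ℂ (colClass A k l) := by
  rw [Fintype.linearIndependent_iff]
  intro c hc a
  have h1 : (Submodule.Quotient.mk (∑ a, c a • (⟨col A a, Submodule.subset_span ⟨a, a.2.2, rfl⟩⟩ :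
      ↥((ofGL A).sub l))) : QuotFiber (ofGL A) k l) = 0 := by
    rw [← hc]
    change Submodule.mkQ _ _ = _
    rw [map_sum]
    rfl
  rw [Submodule.Quotient.mk_eq_zero, Submodule.submoduleOf, Submodule.mem_comap] at h1
  have h2 := (mem_colSpan_repr A k _).1 h1 a.1 a.2.1
  rw [map_sum] at h2
  have h3 := (sum_repr A k l c a.1).symm.trans h2
  rwa [dif_pos a.2] at h3

lemma span_colClass (A : GL (Fin n) ℂ) (k l : Fin (n + 1)) :
    ⊤ ≤ Submodule.span ℂ (Set.range (colClass A k l)) := by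
  rintro x -
  obtain ⟨v, rfl⟩ := Submodule.Quotient.mk_surjective _ x
  set c : BlockIdx k l → ℂ := fun a => (colBasis A).repr v.1 a.1
  have h1 : (Submodule.Quotient.mk v : QuotFiber (ofGL A) k l) = ∑ a, c a • colClass A k l a := by
    have h2 : ∑ a, c a • colClass A k l a = (Submodule.Quotient.mk (∑ a, c a •
        (⟨col A a, Submodule.subset_span ⟨a, a.2.2, rfl⟩⟩ : ↥((ofGL A).sub l))) :
        QuotFiber (ofGL A) k l) := by
      change _ = Submodule.mkQ _ _
      rw [map_sum]
      rfl
    rw [h2, Submodule.Quotient.eq, Submodule.submoduleOf, Submodule.mem_comap]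
    refine (mem_colSpan_repr A k _).2 fun i hi => ?_
    rw [map_sub, map_sum, map_sub, Finsupp.sub_apply]
    have h3 := sum_repr A k l c i
    refine (congrArg _ h3).trans ?_
    split_ifs with h
    · exact sub_self _
    · rw [sub_zero]
      exact (mem_colSpan_repr A l _).1 v.2 i (not_lt.1 fun hl => h ⟨hi, hl⟩)
  rw [h1]
  exact Submodule.sum_mem _ fun a _ => Submodule.smul_mem _ _ (Submodule.subset_span ⟨a, rfl⟩)

/-- The columns of `A` with index in the block give a basis of `E_l / E_k` at the flag of `A`. -/
noncomputable def colClassBasis (A : GL (Fin n) ℂ) (k l : Fin (n + 1)) :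
    Module.Basis (BlockIdx k l) ℂ (QuotFiber (ofGL A) k l) :=
  Module.Basis.mk (linearIndependent_colClass A k l) (span_colClass A k l)

end CompleteFlag

/-! ### The Chern connection and its curvature in a holomorphic frame -/

section Chern

variable {E : Type*} [NormedAddCommGroup E] [NormedSpace ℂ E] [NormedSpace ℝ E]
  [IsScalarTower ℝ ℂ E] {ι : Type*} [Fintype ι] [DecidableEq ι]

/-- `∂f = (df - i df∘J) / 2`, the `(1,0)`-part of the differential of `f : E → ℂ`. -/
noncomputable def dPartial (f : E → ℂ) (z : E) : E →L[ℝ] ℂ :=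
  (1 / 2 : ℂ) • (fderiv ℝ f z - Complex.I • (fderiv ℝ f z).comp
    ((Complex.I • ContinuousLinearMap.id ℂ E).restrictScalars ℝ))

/-- The connection matrix `θ = ∂H · H⁻¹` of the hermitian holomorphic (Chern) connection, in a
holomorphic frame `(s_a)` with Gram matrix `H a b = ⟨s_a, s_b⟩` (linear in `s_a`):
`D s_a = ∑ b, θ a b ⊗ s_b`. -/
noncomputable def chernConnection (H : E → Matrix ι ι ℂ) (a b : ι) (z : E) : E →L[ℝ] ℂ :=
  ∑ c, (H z)⁻¹ c b • dPartial (fun w => H w a c) z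

/-- The curvature matrix `Θ = dθ - θ ∧ θ` of the Chern connection in the frame `(s_a)`, evaluated on
two tangent vectors: `D² s_a = ∑ b, Θ a b ⊗ s_b`. -/
noncomputable def chernCurvature (H : E → Matrix ι ι ℂ) (a b : ι) (z u v : E) : ℂ :=
  extDeriv (fun w => ContinuousAlternatingMap.ofSubsingleton ℝ E ℂ (0 : Fin 1)
      (chernConnection H a b w)) z ![u, v] -
    ∑ c, (chernConnection H a c z u * chernConnection H c b z v -
      chernConnection H a c z v * chernConnection H c b z u)

end Chern

namespace CompleteFlag

variable {n : ℕ}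

/-- A local holomorphic frame of the bundle `E_l / E_k` around the flag `x`, given by holomorphic
sections of `E_l` (that is, holomorphic maps to `ℂⁿ` with values in `E_l`) whose classes form a basis
of the fibres of `E_l / E_k` over an open neighbourhood of `x`. -/
structure HolFrame (x : CompleteFlag n) (k l : Fin (n + 1)) where
  /-- the domain of the frame -/
  dom : Set (CompleteFlag n)
  isOpen_dom : IsOpen dom
  mem_dom : x ∈ dom
  /-- the sections; their values outside `dom` are irrelevant -/
  sec : BlockIdx k l → ∀ y : CompleteFlag n, ↥(y.sub l)
  holomorphic : ∀ a, ContMDiffOn 𝓘(ℂ, Model n) 𝓘(ℂ, EuclideanSpace ℂ (Fin n)) ω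
    (fun y => (sec a y : EuclideanSpace ℂ (Fin n))) dom
  linearIndependent : ∀ y ∈ dom, LinearIndependent ℂ
    fun a => (Submodule.Quotient.mk (sec a y) : QuotFiber y k l)
  span_eq_top : ∀ y ∈ dom, ⊤ ≤ Submodule.span ℂ
    (Set.range fun a => (Submodule.Quotient.mk (sec a y) : QuotFiber y k l))

namespace HolFrame

variable {x : CompleteFlag n} {k l : Fin (n + 1)} (s : HolFrame x k l)

/-- The frame at the point `x`. -/
noncomputable def basis : Module.Basis (BlockIdx k l) ℂ (QuotFiber x k l) :=
  Module.Basis.mk (s.linearIndependent x s.mem_dom) (s.span_eq_top x s.mem_dom)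

/-- The Gram matrix of the frame for the induced metric. -/
noncomputable def gram (y : CompleteFlag n) : Matrix (BlockIdx k l) (BlockIdx k l) ℂ :=
  Matrix.of fun a b => quotMetric y k l (Submodule.Quotient.mk (s.sec a y))
    (Submodule.Quotient.mk (s.sec b y))

/-- The Gram matrix read in the chart at `x`. -/
noncomputable def gramInChart (z : Model n) : Matrix (BlockIdx k l) (BlockIdx k l) ℂ :=
  s.gram ((extChartAt 𝓘(ℂ, Model n) x).symm z)

/-- The curvature `K(u, v) ∈ End(E_l / E_k)` at `x`, on two (real) tangent vectors, of the hermitian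
holomorphic connection of `E_l / E_k` with its induced metric, computed in the frame `s`. -/
noncomputable def curvature (u v : TangentSpace 𝓘(ℝ, Model n) x) :
    QuotFiber x k l →ₗ[ℂ] QuotFiber x k l :=
  s.basis.constr ℂ fun a => ∑ b,
    chernCurvature s.gramInChart a b (extChartAt 𝓘(ℂ, Model n) x x) u v • s.basis b

end HolFrame

/-! ### `SU(n)`, its projection to the flag manifold and its invariant forms -/

/-- The Lie algebra `su(n)` of traceless skew-hermitian matrices. -/
def su (n : ℕ) : Submodule ℝ (Matrix (Fin n) (Fin n) ℂ) where
  carrier := {X | Xᴴ = -X ∧ X.trace = 0}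
  add_mem' := by
    rintro X Y ⟨hX, hX'⟩ ⟨hY, hY'⟩
    exact ⟨by rw [Matrix.conjTranspose_add, hX, hY, neg_add], by
      rw [Matrix.trace_add, hX', hY', add_zero]⟩
  zero_mem' := by simp
  smul_mem' := by
    rintro c X ⟨hX, hX'⟩
    exact ⟨by rw [Matrix.conjTranspose_smul, hX, star_trivial, smul_neg], by
      rw [Matrix.trace_smul, hX', smul_zero]⟩

/-- The inclusion of `SU(n)` in `GL_n(ℂ)`. -/
def suToGL (g : Matrix.specialUnitaryGroup (Fin n) ℂ) : GL (Fin n) ℂ where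
  val := g.1
  inv := star g.1
  val_inv := Matrix.mem_unitaryGroup_iff.1 g.2.1
  inv_val := Matrix.mem_unitaryGroup_iff'.1 g.2.1

/-- The projection `p : SU(n) → F(ℂ)`. -/
noncomputable def ofSU (g : Matrix.specialUnitaryGroup (Fin n) ℂ) : CompleteFlag n :=
  ofGL (suToGL g)

/-- The exponential of a matrix, as an invertible matrix. -/
noncomputable def expGL (X : Matrix (Fin n) (Fin n) ℂ) : GL (Fin n) ℂ := (Matrix.isUnit_exp X).unit

/-- The image under `dp_g` of the value at `g` of the left invariant vector field `X` on `SU(n)`: the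
velocity at `t = 0` of the curve `t ↦ p(g exp(tX))`, read in the chart at `p(g)`. -/
noncomputable def pushforward (g : Matrix.specialUnitaryGroup (Fin n) ℂ) (X : su n) :
    TangentSpace 𝓘(ℝ, Model n) (ofSU g) :=
  deriv (fun t : ℝ => extChartAt 𝓘(ℂ, Model n) (ofSU g) (ofGL (suToGL g * expGL (t • X.1)))) 0

/-- The functional `ω^{ij}`: on the complexified Lie algebra it is the coordinate along
`e_{ij} = E_{ij}`. A left invariant complex-valued `1`-form on `SU(n)` is its value at the identity, so
that `ω^{ij}` takes on the left invariant field `X` the constant value `X i j`. -/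
def omegaForm (i j : Fin n) : Module.Dual ℂ (Matrix (Fin n) (Fin n) ℂ) := Matrix.entryLinearMap ℂ ℂ i j

/-- The functional `ω̄^{ij}`: the coordinate along `ē_{ij} = -E_{ji}`. On `su(n)` it is the complex
conjugate of `ω^{ij}`. -/
def omegaBarForm (i j : Fin n) : Module.Dual ℂ (Matrix (Fin n) (Fin n) ℂ) :=
  -Matrix.entryLinearMap ℂ ℂ j i

/-- The wedge product of two left invariant `1`-forms, evaluated on left invariant fields. -/
def wedge (φ ψ : Module.Dual ℂ (Matrix (Fin n) (Fin n) ℂ)) (X Y : su n) : ℂ :=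
  φ X.1 * ψ Y.1 - φ Y.1 * ψ X.1

/-- `p^* K` for the curvature `K` of `E_l / E_k`, at `g ∈ SU(n)`, on left invariant fields. -/
noncomputable def curvatureSU {g : Matrix.specialUnitaryGroup (Fin n) ℂ} {k l : Fin (n + 1)}
    (s : HolFrame (ofSU g) k l) (X Y : su n) :
    QuotFiber (ofSU g) k l →ₗ[ℂ] QuotFiber (ofSU g) k l :=
  s.curvature (pushforward g X) (pushforward g Y)

/-- The entries `Θ a b` of the matrix of `p^* K` in the tautological unitary frame `([g_a])` of
`E_l / E_k` formed by the columns of `g`: `K [g_a] = ∑ b, Θ a b ⊗ [g_b]`. -/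
noncomputable def curvatureMatrix {g : Matrix.specialUnitaryGroup (Fin n) ℂ} {k l : Fin (n + 1)}
    (s : HolFrame (ofSU g) k l) (X Y : su n) (a b : BlockIdx k l) : ℂ :=
  (colClassBasis (suToGL g) k l).repr
    (curvatureSU s X Y (colClassBasis (suToGL g) k l a)) b

/-- The pullback to `SU(n)` of the first Chern form `c_1 = Tr (i/2π K)` of `E_l / E_k`. -/
noncomputable def firstChernSU {g : Matrix.specialUnitaryGroup (Fin n) ℂ} {k l : Fin (n + 1)}
    (s : HolFrame (ofSU g) k l) (X Y : su n) : ℂ :=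
  LinearMap.trace ℂ _ ((Complex.I / (2 * Real.pi) : ℂ) • curvatureSU s X Y)

/-- `ω_{ij} = γ ω^{ji}`. -/
def omegaLow (γ : ℂ) (i j : Fin n) : Module.Dual ℂ (Matrix (Fin n) (Fin n) ℂ) := γ • omegaForm j i

/-- `ω̄_{ij} = γ ω̄^{ji}`. -/
def omegaBarLow (γ : ℂ) (i j : Fin n) : Module.Dual ℂ (Matrix (Fin n) (Fin n) ℂ) :=
  γ • omegaBarForm j i

/-- `Ω_{ij} = ω_{ij} ∧ ω̄_{ij}`. -/
def Omega (γ : ℂ) (i j : Fin n) (X Y : su n) : ℂ :=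
  wedge (omegaLow γ i j) (omegaBarLow γ i j) X Y

end CompleteFlag

open CompleteFlag

/-!
For a holomorphic frame with Gram matrix `H`, expanding `dθ - θ ∧ θ` with `θ = ∂H H⁻¹` gives the
curvature matrix `Θ = (∂̄∂H + ∂H ∧ H⁻¹ ∂̄H) H⁻¹` (`chernCurvatureMat_eq`). From this formula a
holomorphic change of frame `H = M H₀ Mᴴ` conjugates the curvature, `Θ M = M Θ₀`
(`chernCurvatureMat_gauge`), so one convenient frame of `E_l / E_k` is enough.

Fix `g ∈ SU(n)`. The preferred chart at the flag of `g` is `U ↦ flag of A U`, with `U` lower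
unitriangular and `A = g T` for some upper triangular `T`. As right multiplication by an upper
triangular matrix does not change the flag, the flag of `A U` is also that of `g W` with
`W = T U T⁻¹`, which is affine in the chart coordinates and equal to `1` at the origin. The columns
of `g W` with index in the block are a holomorphic frame of `E_l / E_k`. Since `g` is unitary, their
Gram matrix for the quotient metric is the Schur complement
`V₂ V₂ᴴ - V₂ V₁ᴴ (V₁ V₁ᴴ)⁻¹ V₁ V₂ᴴ`, where `V₁` and `V₂` consist of the rows of `Wᵀ` with index
below `k` and in the block (`inner_starProjection_col`). At the origin these rows are orthonormal, and
the curvature formula becomes the difference of two second fundamental form terms, one for the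
directions in `E_k` and one for those orthogonal to `E_l` (`chernCurvatureMat_schurGram`,
`chernCurvatureMat_tautGram`).

It remains to evaluate `dW` on the velocity of `t ↦ p(g exp(tX))`. In the chart this curve is
`U(t) = T⁻¹ exp(tX) C(t)` with `C(t)` upper triangular and `C(0) = T`; hence `dW = T U'(0) T⁻¹` and `X`
agree below the diagonal (`conj_lowerUni_pushforward`), and only such entries occur in the
curvature. With `X_{ij}` conjugate to `-X_{ji}` on `su(n)` this is the asserted formula
(`curvatureMatrix_eq`); the two normalized statements are its trace for `l = k + 1` and its case
`k = 0`.
-/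

/-! ### Calculus of matrix-valued functions -/

section MatrixCalculus

variable {E : Type*} [NormedAddCommGroup E] [NormedSpace ℝ E] {ι κ μ : Type*}

/-- A matrix-valued function is `C^m` at `z` if all its entries are. -/
def MatContDiffAt (m : WithTop ℕ∞) (F : E → Matrix ι κ ℂ) (z : E) : Prop :=
  ∀ i j, ContDiffAt ℝ m (fun w => F w i j) z

/-- A matrix-valued function is differentiable at `z` if all its entries are. -/
def MatDiffAt (F : E → Matrix ι κ ℂ) (z : E) : Prop :=
  ∀ i j, DifferentiableAt ℝ (fun w => F w i j) z

/-- The differential of a matrix-valued function at `z`, in the direction `u`. -/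
noncomputable def dMat (F : E → Matrix ι κ ℂ) (z u : E) : Matrix ι κ ℂ :=
  Matrix.of fun i j => fderiv ℝ (fun w => F w i j) z u

variable {F G : E → Matrix ι κ ℂ} {z u v : E}

lemma MatContDiffAt.matDiffAt {m : WithTop ℕ∞} (h : MatContDiffAt m F z) (hm : m ≠ 0) :
    MatDiffAt F z := fun i j => (h i j).differentiableAt hm

lemma MatContDiffAt.of_le {m m' : WithTop ℕ∞} (h : MatContDiffAt m F z) (hm : m' ≤ m) :
    MatContDiffAt m' F z := fun i j => (h i j).of_le hm

lemma MatContDiffAt.eventually (h : MatContDiffAt 2 F z) [Finite ι] [Finite κ] :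
    ∀ᶠ w in nhds z, MatContDiffAt 2 F w := by
  simp only [MatContDiffAt, Filter.eventually_all]
  exact fun i j => (h i j).eventually (by simp)

lemma MatContDiffAt.mul [Fintype κ] {m : WithTop ℕ∞} {G : E → Matrix κ μ ℂ}
    (hF : MatContDiffAt m F z) (hG : MatContDiffAt m G z) :
    MatContDiffAt m (fun w => F w * G w) z := fun i j => by
  simp only [Matrix.mul_apply]
  exact ContDiffAt.sum fun c _ => (hF i c).mul (hG c j)

lemma MatContDiffAt.sub {m : WithTop ℕ∞} (hF : MatContDiffAt m F z) (hG : MatContDiffAt m G z) :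
    MatContDiffAt m (fun w => F w - G w) z := fun i j => (hF i j).sub (hG i j)

lemma MatContDiffAt.conjTranspose {m : WithTop ℕ∞} (hF : MatContDiffAt m F z) :
    MatContDiffAt m (fun w => (F w)ᴴ) z := fun i j =>
  Complex.conjCLE.contDiff.contDiffAt.comp z (hF j i)

lemma MatContDiffAt.det [Fintype ι] [DecidableEq ι] {m : WithTop ℕ∞} {F : E → Matrix ι ι ℂ}
    (hF : MatContDiffAt m F z) : ContDiffAt ℝ m (fun w => (F w).det) z := by
  simp only [Matrix.det_apply]
  exact ContDiffAt.sum fun σ _ => (contDiffAt_prod fun i _ => hF _ _).const_smul _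

lemma MatContDiffAt.inv [Fintype ι] [DecidableEq ι] {m : WithTop ℕ∞} {F : E → Matrix ι ι ℂ}
    (hF : MatContDiffAt m F z) (h0 : (F z).det ≠ 0) : MatContDiffAt m (fun w => (F w)⁻¹) z := by
  intro i j
  simp only [Matrix.inv_def, Ring.inverse_eq_inv', Matrix.smul_apply, smul_eq_mul,
    Matrix.adjugate_apply]
  refine (hF.det.inv h0).mul (MatContDiffAt.det fun a b => ?_)
  simp only [Matrix.updateRow_apply]
  split_ifs
  · exact contDiffAt_const
  · exact hF a b

lemma MatContDiffAt.det_ne_zero_eventually [Fintype ι] [DecidableEq ι] {m : WithTop ℕ∞}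
    {F : E → Matrix ι ι ℂ} (hF : MatContDiffAt m F z) (h0 : (F z).det ≠ 0) :
    ∀ᶠ w in nhds z, (F w).det ≠ 0 :=
  hF.det.continuousAt.eventually_ne h0

lemma MatDiffAt.mul [Fintype κ] {G : E → Matrix κ μ ℂ} (hF : MatDiffAt F z) (hG : MatDiffAt G z) :
    MatDiffAt (fun w => F w * G w) z := fun i j => by
  simp only [Matrix.mul_apply]
  exact DifferentiableAt.fun_sum fun c _ => (hF i c).mul (hG c j)

lemma dMat_congr (h : F =ᶠ[nhds z] G) : dMat F z u = dMat G z u := by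
  ext i j
  have : (fun w => F w i j) =ᶠ[nhds z] fun w => G w i j := h.mono fun w hw => by simp only [hw]
  simp only [dMat, Matrix.of_apply, this.fderiv_eq]

lemma dMat_const (C : Matrix ι κ ℂ) : dMat (fun _ => C) z u = 0 := by
  ext i j
  simp [dMat]

lemma dMat_add (hF : MatDiffAt F z) (hG : MatDiffAt G z) :
    dMat (fun w => F w + G w) z u = dMat F z u + dMat G z u := by
  ext i j
  simp only [dMat, Matrix.of_apply, Matrix.add_apply]
  rw [fderiv_fun_add (hF i j) (hG i j)]
  rfl

lemma dMat_sub (hF : MatDiffAt F z) (hG : MatDiffAt G z) :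
    dMat (fun w => F w - G w) z u = dMat F z u - dMat G z u := by
  ext i j
  simp only [dMat, Matrix.of_apply, Matrix.sub_apply]
  rw [fderiv_fun_sub (hF i j) (hG i j)]
  rfl

lemma dMat_mul [Fintype κ] {G : E → Matrix κ μ ℂ} (hF : MatDiffAt F z) (hG : MatDiffAt G z) :
    dMat (fun w => F w * G w) z u = dMat F z u * G z + F z * dMat G z u := by
  ext i j
  simp only [dMat, Matrix.of_apply, Matrix.add_apply, Matrix.mul_apply]
  rw [fderiv_fun_sum fun c _ => (hF i c).fun_mul (hG c j), sum_apply,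
    ← Finset.sum_add_distrib]
  refine Finset.sum_congr rfl fun c _ => ?_
  rw [fderiv_fun_mul (hF i c) (hG c j)]
  simp only [add_apply, smul_apply, smul_eq_mul]
  ring

lemma dMat_conjTranspose (F : E → Matrix ι κ ℂ) :
    dMat (fun w => (F w)ᴴ) z u = (dMat F z u)ᴴ := by
  ext i j
  change fderiv ℝ (Complex.conjCLE ∘ fun w => F w j i) z u = _
  rw [ContinuousLinearEquiv.comp_fderiv]
  rfl

/-- The differential of the inverse: `d(F⁻¹) = -F⁻¹ dF F⁻¹`. -/
lemma dMat_inv [Fintype ι] [DecidableEq ι] {F : E → Matrix ι ι ℂ}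
    (hF : MatContDiffAt 1 F z) (h0 : (F z).det ≠ 0) :
    dMat (fun w => (F w)⁻¹) z u = -((F z)⁻¹ * dMat F z u * (F z)⁻¹) := by
  have h1 : (fun w => F w * (F w)⁻¹) =ᶠ[nhds z] fun _ => 1 :=
    (hF.det_ne_zero_eventually h0).mono fun w hw =>
      Matrix.mul_nonsing_inv _ (isUnit_iff_ne_zero.2 hw)
  have h2 := dMat_congr (u := u) h1
  rw [dMat_const, dMat_mul (hF.matDiffAt one_ne_zero) ((hF.inv h0).matDiffAt one_ne_zero)] at h2
  have h3 : (F z)⁻¹ * F z = 1 := Matrix.nonsing_inv_mul _ (isUnit_iff_ne_zero.2 h0)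
  have h4 := congrArg (fun Y => (F z)⁻¹ * Y) h2
  simp only [Matrix.mul_add, ← Matrix.mul_assoc, h3, Matrix.one_mul, Matrix.mul_zero] at h4
  exact eq_neg_of_add_eq_zero_right h4

end MatrixCalculus

/-! ### The operators `∂`, `∂̄` and `d∂` on matrix-valued functions -/

section Dolbeault

variable {E : Type*} [NormedAddCommGroup E] [NormedSpace ℂ E] [NormedSpace ℝ E]
  {ι κ μ : Type*}

/-- `∂F` at `z` in the direction `u`, for a matrix-valued function `F`. -/
noncomputable def delMat (F : E → Matrix ι κ ℂ) (z u : E) : Matrix ι κ ℂ :=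
  (1 / 2 : ℂ) • (dMat F z u - Complex.I • dMat F z (Complex.I • u))

/-- `∂̄F` at `z` in the direction `u`, for a matrix-valued function `F`. -/
noncomputable def delBarMat (F : E → Matrix ι κ ℂ) (z u : E) : Matrix ι κ ℂ :=
  (1 / 2 : ℂ) • (dMat F z u + Complex.I • dMat F z (Complex.I • u))

/-- The two-form `d∂F = ∂̄∂F` at `z` on the vectors `u`, `v`, for a matrix-valued function `F`. -/
noncomputable def ddMat (F : E → Matrix ι κ ℂ) (z u v : E) : Matrix ι κ ℂ :=
  dMat (fun w => delMat F w v) z u - dMat (fun w => delMat F w u) z v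

/-- A matrix-valued function is holomorphic of class `C²` near `z`: the entries are twice
continuously differentiable at `z`, and the differential is complex linear near `z`. -/
def MatHolAt (F : E → Matrix ι κ ℂ) (z : E) : Prop :=
  MatContDiffAt 2 F z ∧ ∀ᶠ w in nhds z, ∀ u, dMat F w (Complex.I • u) = Complex.I • dMat F w u

variable {F G : E → Matrix ι κ ℂ} {z u v : E}

lemma delMat_add_delBarMat : delMat F z u + delBarMat F z u = dMat F z u := by
  rw [delMat, delBarMat]
  module

lemma delMat_congr (h : F =ᶠ[nhds z] G) : delMat F z u = delMat G z u := by
  rw [delMat, delMat, dMat_congr h, dMat_congr h]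

lemma delBarMat_congr (h : F =ᶠ[nhds z] G) : delBarMat F z u = delBarMat G z u := by
  rw [delBarMat, delBarMat, dMat_congr h, dMat_congr h]

lemma ddMat_congr (h : F =ᶠ[nhds z] G) : ddMat F z u v = ddMat G z u v := by
  have h1 : ∀ v, (fun w => delMat F w v) =ᶠ[nhds z] fun w => delMat G w v := fun v =>
    h.eventuallyEq_nhds.mono fun w hw => delMat_congr hw
  rw [ddMat, ddMat, dMat_congr (h1 u), dMat_congr (h1 v)]

lemma delMat_mul [Fintype κ] {G : E → Matrix κ μ ℂ} (hF : MatDiffAt F z) (hG : MatDiffAt G z) :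
    delMat (fun w => F w * G w) z u = delMat F z u * G z + F z * delMat G z u := by
  simp only [delMat, dMat_mul hF hG, Matrix.smul_mul, Matrix.mul_smul, Matrix.sub_mul,
    Matrix.mul_sub]
  module

lemma delBarMat_mul [Fintype κ] {G : E → Matrix κ μ ℂ} (hF : MatDiffAt F z) (hG : MatDiffAt G z) :
    delBarMat (fun w => F w * G w) z u = delBarMat F z u * G z + F z * delBarMat G z u := by
  simp only [delBarMat, dMat_mul hF hG, Matrix.smul_mul, Matrix.mul_smul, Matrix.add_mul,
    Matrix.mul_add]
  module

lemma delMat_sub (hF : MatDiffAt F z) (hG : MatDiffAt G z) :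
    delMat (fun w => F w - G w) z u = delMat F z u - delMat G z u := by
  simp only [delMat, dMat_sub hF hG]
  module

lemma delBarMat_sub (hF : MatDiffAt F z) (hG : MatDiffAt G z) :
    delBarMat (fun w => F w - G w) z u = delBarMat F z u - delBarMat G z u := by
  simp only [delBarMat, dMat_sub hF hG]
  module

lemma MatContDiffAt.delMat (hF : MatContDiffAt 2 F z) (v : E) :
    MatDiffAt (fun w => delMat F w v) z := by
  intro i j
  have h : ∀ u, DifferentiableAt ℝ (fun w => fderiv ℝ (fun w => F w i j) w u) z := fun u =>
    (((hF i j).fderiv_right (m := 1) (by norm_num)).differentiableAt one_ne_zero).clm_apply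
      (differentiableAt_const u)
  simp only [_root_.delMat, dMat, Matrix.smul_apply, Matrix.sub_apply, Matrix.of_apply, smul_eq_mul]
  exact ((h v).sub ((h _).const_mul _)).const_mul _

/-- The product rule for `d∂`. -/
lemma ddMat_mul [Fintype κ] [Finite ι] [Finite μ] {G : E → Matrix κ μ ℂ}
    (hF : MatContDiffAt 2 F z) (hG : MatContDiffAt 2 G z) :
    ddMat (fun w => F w * G w) z u v = ddMat F z u v * G z + F z * ddMat G z u v
      + (delBarMat F z u * delMat G z v - delBarMat F z v * delMat G z u)
      - (delMat F z u * delBarMat G z v - delMat F z v * delBarMat G z u) := by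
  have h1 : ∀ v, (fun w => delMat (fun w => F w * G w) w v) =ᶠ[nhds z]
      fun w => delMat F w v * G w + F w * delMat G w v := fun v => by
    filter_upwards [hF.eventually, hG.eventually] with w h2 h3
    exact delMat_mul (h2.matDiffAt two_ne_zero) (h3.matDiffAt two_ne_zero)
  have h4 := hF.matDiffAt two_ne_zero
  have h5 := hG.matDiffAt two_ne_zero
  have h6 : ∀ u v, dMat (fun w => delMat (fun w => F w * G w) w v) z u =
      dMat (fun w => delMat F w v) z u * G z + delMat F z v * dMat G z u +
      (dMat F z u * delMat G z v + F z * dMat (fun w => delMat G w v) z u) := fun u v => by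
    rw [dMat_congr (h1 v), dMat_add ((hF.delMat v).mul h5) (h4.mul (hG.delMat v)),
      dMat_mul (hF.delMat v) h5, dMat_mul h4 (hG.delMat v)]
  rw [ddMat, h6, h6]
  simp only [← delMat_add_delBarMat, ddMat, Matrix.mul_add, Matrix.add_mul, Matrix.mul_sub,
    Matrix.sub_mul]
  abel

lemma ddMat_sub [Finite ι] [Finite κ] (hF : MatContDiffAt 2 F z) (hG : MatContDiffAt 2 G z) :
    ddMat (fun w => F w - G w) z u v = ddMat F z u v - ddMat G z u v := by
  have h1 : ∀ v, (fun w => delMat (fun w => F w - G w) w v) =ᶠ[nhds z]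
      fun w => delMat F w v - delMat G w v := fun v => by
    filter_upwards [hF.eventually, hG.eventually] with w h2 h3
    exact delMat_sub (h2.matDiffAt two_ne_zero) (h3.matDiffAt two_ne_zero)
  rw [ddMat, dMat_congr (h1 u), dMat_congr (h1 v), dMat_sub (hF.delMat _) (hG.delMat _),
    dMat_sub (hF.delMat _) (hG.delMat _), ddMat, ddMat]
  abel

namespace MatHolAt

lemma contDiffAt (h : MatHolAt F z) : MatContDiffAt 2 F z := h.1

lemma delMat_eventuallyEq (h : MatHolAt F z) :
    ∀ᶠ w in nhds z, ∀ u, delMat F w u = dMat F w u := h.2.mono fun w hw u => by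
  rw [delMat, hw, smul_smul, Complex.I_mul_I]
  module

lemma delMat (h : MatHolAt F z) : delMat F z u = dMat F z u := h.delMat_eventuallyEq.self_of_nhds u

lemma delBarMat (h : MatHolAt F z) : delBarMat F z u = 0 := by
  rw [_root_.delBarMat, h.2.self_of_nhds, smul_smul, Complex.I_mul_I]
  module

/-- For holomorphic `F` the two-form `d∂F` is `ddF = 0`, by the symmetry of second derivatives. -/
lemma ddMat (h : MatHolAt F z) : ddMat F z u v = 0 := by
  have h1 : ∀ v, (fun w => _root_.delMat F w v) =ᶠ[nhds z] fun w => dMat F w v := fun v =>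
    h.delMat_eventuallyEq.mono fun w hw => hw v
  rw [_root_.ddMat, dMat_congr (h1 u), dMat_congr (h1 v)]
  ext i j
  have h2 : DifferentiableAt ℝ (fderiv ℝ (fun w => F w i j)) z :=
    ((h.1 i j).fderiv_right (m := 1) (by norm_num)).differentiableAt one_ne_zero
  have h3 : ∀ u v, fderiv ℝ (fun w => fderiv ℝ (fun w => F w i j) w v) z u =
      fderiv ℝ (fderiv ℝ (fun w => F w i j)) z u v := fun u v => by
    rw [fderiv_clm_apply h2 (differentiableAt_const v)]
    simp
  have h4 := (h.1 i j).isSymmSndFDerivAt (by simp)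
  simp only [dMat, Matrix.sub_apply, Matrix.of_apply, h3, Matrix.zero_apply]
  rw [h4.eq, sub_self]

lemma delMat_conjTranspose_eventuallyEq (h : MatHolAt F z) :
    ∀ᶠ w in nhds z, ∀ u, _root_.delMat (fun w => (F w)ᴴ) w u = 0 := h.2.mono fun w hw u => by
  rw [_root_.delMat, dMat_conjTranspose, dMat_conjTranspose, hw, Matrix.conjTranspose_smul,
    smul_smul, Complex.star_def, Complex.conj_I, mul_neg, Complex.I_mul_I]
  module

lemma delMat_conjTranspose (h : MatHolAt F z) : _root_.delMat (fun w => (F w)ᴴ) z u = 0 :=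
  h.delMat_conjTranspose_eventuallyEq.self_of_nhds u

lemma delBarMat_conjTranspose (h : MatHolAt F z) :
    _root_.delBarMat (fun w => (F w)ᴴ) z u = (dMat F z u)ᴴ := by
  have := delMat_add_delBarMat (F := fun w => (F w)ᴴ) (z := z) (u := u)
  rwa [h.delMat_conjTranspose, zero_add, dMat_conjTranspose] at this

lemma ddMat_conjTranspose (h : MatHolAt F z) : _root_.ddMat (fun w => (F w)ᴴ) z u v = 0 := by
  have h1 : ∀ v, (fun w => _root_.delMat (fun w => (F w)ᴴ) w v) =ᶠ[nhds z] fun _ => 0 := fun v =>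
    h.delMat_conjTranspose_eventuallyEq.mono fun w hw => hw v
  rw [_root_.ddMat, dMat_congr (h1 u), dMat_congr (h1 v), dMat_const, dMat_const, sub_self]

/-- Holomorphic entries give a holomorphic matrix. -/
lemma of_contDiffAt [IsScalarTower ℝ ℂ E] [Finite ι] [Finite κ]
    (h : ∀ i j, ContDiffAt ℂ ω (fun w => F w i j) z) : MatHolAt F z := by
  refine ⟨fun i j => ((h i j).restrict_scalars ℝ).of_le le_top, ?_⟩
  have h1 : ∀ᶠ w in nhds z, ∀ i j, DifferentiableAt ℂ (fun w => F w i j) w := by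
    simp only [Filter.eventually_all]
    intro i j
    exact (((h i j).of_le (m := 1) le_top).eventually (by simp)).mono
      fun w hw => hw.differentiableAt one_ne_zero
  refine h1.mono fun w hw u => ?_
  ext i j
  simp only [dMat, Matrix.of_apply, Matrix.smul_apply]
  rw [(hw i j).fderiv_restrictScalars ℝ]
  simp

end MatHolAt

end Dolbeault

/-! ### The Chern curvature as a matrix -/

lemma extDeriv_ofSubsingleton {E : Type*} [NormedAddCommGroup E] [NormedSpace ℝ E] {z u v : E}
    {f : E → E →L[ℝ] ℂ} (hf : DifferentiableAt ℝ f z) :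
    extDeriv (fun w => ContinuousAlternatingMap.ofSubsingleton ℝ E ℂ (0 : Fin 1) (f w)) z ![u, v]
      = fderiv ℝ (fun w => f w v) z u - fderiv ℝ (fun w => f w u) z v := by
  have h1 : DifferentiableAt ℝ
      (fun w => ContinuousAlternatingMap.ofSubsingleton ℝ E ℂ (0 : Fin 1) (f w)) z :=
    ((ContinuousAlternatingMap.ofSubsingletonLIE (𝕜 := ℝ) (E := E) (F := ℂ)
      (0 : Fin 1)).toContinuousLinearEquiv.differentiableAt).comp z hf
  rw [extDeriv_apply h1, Fin.sum_univ_two]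
  simp [Fin.removeNth, sub_eq_add_neg]

lemma dPartial_eq_delMat {E : Type*} [NormedAddCommGroup E] [NormedSpace ℂ E] [NormedSpace ℝ E]
    [IsScalarTower ℝ ℂ E] {ι κ : Type*} (H : E → Matrix ι κ ℂ) (a : ι) (b : κ) (z v : E) :
    dPartial (fun w => H w a b) z v = delMat H z v a b := by
  simp [dPartial, delMat, dMat]

section ChernCurvature

variable {E : Type*} [NormedAddCommGroup E] [NormedSpace ℂ E] [NormedSpace ℝ E]
  [IsScalarTower ℝ ℂ E] {ι κ : Type*} [Fintype ι] [DecidableEq ι] [Fintype κ] [DecidableEq κ]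
  {H H₀ M : E → Matrix ι ι ℂ} {z u v : E}

lemma chernConnection_apply (H : E → Matrix ι ι ℂ) (a b : ι) (z v : E) :
    chernConnection H a b z v = (delMat H z v * (H z)⁻¹) a b := by
  rw [chernConnection, Matrix.mul_apply, sum_apply]
  refine Finset.sum_congr rfl fun c _ => ?_
  rw [smul_apply, dPartial_eq_delMat, smul_eq_mul, mul_comm]

lemma differentiableAt_chernConnection (hH : MatContDiffAt 2 H z) (h0 : (H z).det ≠ 0) (a b : ι) :
    DifferentiableAt ℝ (chernConnection H a b) z := by
  unfold chernConnection
  refine DifferentiableAt.fun_sum fun c _ => ?_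
  have h1 := ((hH.inv h0).matDiffAt two_ne_zero) c b
  have h2 : DifferentiableAt ℝ (fun w => fderiv ℝ (fun w => H w a c) w) z :=
    ((hH a c).fderiv_right (m := 1) (by norm_num)).differentiableAt one_ne_zero
  refine h1.smul ?_
  unfold dPartial
  exact (h2.sub ((h2.clm_comp (differentiableAt_const _)).const_smul Complex.I)).const_smul (1 / 2 : ℂ)

/-- The curvature matrix is `(∂̄∂H + ∂H ∧ H⁻¹ ∂̄H) H⁻¹`. -/
lemma chernCurvature_eq (hH : MatContDiffAt 2 H z) (h0 : (H z).det ≠ 0) (a b : ι) :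
    chernCurvature H a b z u v = ((ddMat H z u v + (delMat H z u * (H z)⁻¹ * delBarMat H z v
      - delMat H z v * (H z)⁻¹ * delBarMat H z u)) * (H z)⁻¹) a b := by
  have h1 : ∀ u v, fderiv ℝ (fun w => chernConnection H a b w v) z u =
      (dMat (fun w => delMat H w v) z u * (H z)⁻¹ -
        delMat H z v * ((H z)⁻¹ * (delMat H z u + delBarMat H z u) * (H z)⁻¹)) a b := fun u v => by
    simp only [chernConnection_apply]
    rw [delMat_add_delBarMat, sub_eq_add_neg, ← mul_neg,
      ← dMat_inv (hH.of_le one_le_two) h0,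
      ← dMat_mul (hH.delMat v) ((hH.inv h0).matDiffAt two_ne_zero)]
    rfl
  have h2 : ∀ u v, ∑ c, chernConnection H a c z u * chernConnection H c b z v =
      (delMat H z u * (H z)⁻¹ * (delMat H z v * (H z)⁻¹)) a b := fun u v => by
    simp only [chernConnection_apply]
    rw [← Matrix.mul_apply]
  rw [chernCurvature, extDeriv_ofSubsingleton (differentiableAt_chernConnection hH h0 a b),
    Finset.sum_sub_distrib, h1, h1, h2, h2]
  simp only [← Matrix.sub_apply]
  refine congrFun (congrFun (?_ : (_ : Matrix ι ι ℂ) = _) a) b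
  simp only [ddMat, mul_add, add_mul, sub_mul, mul_assoc]
  abel

/-- The curvature matrix, as a matrix. -/
noncomputable def chernCurvatureMat (H : E → Matrix ι ι ℂ) (z u v : E) : Matrix ι ι ℂ :=
  Matrix.of fun a b => chernCurvature H a b z u v

lemma chernCurvatureMat_eq (hH : MatContDiffAt 2 H z) (h0 : (H z).det ≠ 0) :
    chernCurvatureMat H z u v = (ddMat H z u v + (delMat H z u * (H z)⁻¹ * delBarMat H z v
      - delMat H z v * (H z)⁻¹ * delBarMat H z u)) * (H z)⁻¹ := by
  ext a b
  exact chernCurvature_eq hH h0 a b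

/-- Under a holomorphic change of frame `M` the curvature matrix is conjugated by `M`. -/
lemma chernCurvatureMat_gauge (hH₀ : MatContDiffAt 2 H₀ z) (hM : MatHolAt M z)
    (h0 : (H₀ z).det ≠ 0) (hM0 : (M z).det ≠ 0)
    (h : H =ᶠ[nhds z] fun w => M w * (H₀ w * (M w)ᴴ)) :
    chernCurvatureMat H z u v * M z = M z * chernCurvatureMat H₀ z u v := by
  have hMh := hM.contDiffAt.conjTranspose
  have hHM := hH₀.mul hMh
  have hH : MatContDiffAt 2 H z := fun i j =>
    (hM.contDiffAt.mul hHM i j).congr_of_eventuallyEq (h.mono fun w hw => by simp only [hw])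
  have hz : H z = M z * (H₀ z * (M z)ᴴ) := h.self_of_nhds
  have hz0 : (H z).det ≠ 0 := by
    rw [hz, Matrix.det_mul, Matrix.det_mul, Matrix.det_conjTranspose]
    exact mul_ne_zero hM0 (mul_ne_zero h0 (star_ne_zero.2 hM0))
  have two : (2 : WithTop ℕ∞) ≠ 0 := two_ne_zero
  have e1 : ∀ u, delMat H z u = dMat M z u * (H₀ z * (M z)ᴴ) + M z * (delMat H₀ z u * (M z)ᴴ) :=
    fun u => by
      rw [delMat_congr h, delMat_mul (hM.contDiffAt.matDiffAt two) (hHM.matDiffAt two),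
        delMat_mul (hH₀.matDiffAt two) (hMh.matDiffAt two), hM.delMat, hM.delMat_conjTranspose,
        mul_zero, add_zero]
  have e2 : ∀ u, delBarMat (fun w => H₀ w * (M w)ᴴ) z u =
      delBarMat H₀ z u * (M z)ᴴ + H₀ z * (dMat M z u)ᴴ := fun u => by
    rw [delBarMat_mul (hH₀.matDiffAt two) (hMh.matDiffAt two), hM.delBarMat_conjTranspose]
  have e3 : ∀ u, delBarMat H z u = M z * (delBarMat H₀ z u * (M z)ᴴ + H₀ z * (dMat M z u)ᴴ) :=
    fun u => by
      rw [delBarMat_congr h, delBarMat_mul (hM.contDiffAt.matDiffAt two) (hHM.matDiffAt two),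
        hM.delBarMat, e2, zero_mul, zero_add]
  have e4 : ddMat H z u v = M z * (ddMat H₀ z u v * (M z)ᴴ
      - (delMat H₀ z u * (dMat M z v)ᴴ - delMat H₀ z v * (dMat M z u)ᴴ))
      - (dMat M z u * (delBarMat H₀ z v * (M z)ᴴ + H₀ z * (dMat M z v)ᴴ)
        - dMat M z v * (delBarMat H₀ z u * (M z)ᴴ + H₀ z * (dMat M z u)ᴴ)) := by
    rw [ddMat_congr h, ddMat_mul hM.contDiffAt hHM, ddMat_mul hH₀ hMh, hM.ddMat,
      hM.ddMat_conjTranspose, hM.delBarMat, hM.delBarMat, hM.delMat_conjTranspose,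
      hM.delMat_conjTranspose, hM.delMat, hM.delMat, hM.delBarMat_conjTranspose,
      hM.delBarMat_conjTranspose, e2, e2]
    simp
  have i1 : (H z)⁻¹ = ((M z)ᴴ)⁻¹ * (H₀ z)⁻¹ * (M z)⁻¹ := by
    rw [hz, Matrix.mul_inv_rev, Matrix.mul_inv_rev]
  have u1 : IsUnit (M z).det := isUnit_iff_ne_zero.2 hM0
  have u2 : IsUnit (H₀ z).det := isUnit_iff_ne_zero.2 h0
  have u3 : IsUnit ((M z)ᴴ).det := by
    rw [Matrix.det_conjTranspose]
    exact u1.star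
  rw [chernCurvatureMat_eq hH hz0, chernCurvatureMat_eq hH₀ h0, i1, e4]
  simp only [e1, e3]
  set m := M z
  set mh := (M z)ᴴ
  set k := H₀ z
  have c1 : m⁻¹ * m = 1 := Matrix.nonsing_inv_mul _ u1
  have c2 : k * k⁻¹ = 1 := Matrix.mul_nonsing_inv _ u2
  have c2' : k⁻¹ * k = 1 := Matrix.nonsing_inv_mul _ u2
  have c3 : mh * mh⁻¹ = 1 := Matrix.mul_nonsing_inv _ u3
  have d1 : ∀ x, m⁻¹ * (m * x) = x := fun x => by rw [← mul_assoc, c1, one_mul]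
  have d2 : ∀ x, k * (k⁻¹ * x) = x := fun x => by rw [← mul_assoc, c2, one_mul]
  have d2' : ∀ x, k⁻¹ * (k * x) = x := fun x => by rw [← mul_assoc, c2', one_mul]
  have d3 : ∀ x, mh * (mh⁻¹ * x) = x := fun x => by rw [← mul_assoc, c3, one_mul]
  simp only [mul_add, add_mul, mul_sub, sub_mul, mul_assoc, d1, d2, d2', d3, c1, mul_one]
  abel

variable {ν : Type*} [Fintype ν] [DecidableEq ν] {V₁ : E → Matrix κ ν ℂ} {V₂ : E → Matrix ι ν ℂ}

/-- The Gram matrix of the orthogonal projections of the rows of `V₂` to the orthogonal complement of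
the span of the rows of `V₁`, as a Schur complement; this needs `V₁ V₁ᴴ` to be invertible. -/
noncomputable def schurGram (V₁ : Matrix κ ν ℂ) (V₂ : Matrix ι ν ℂ) : Matrix ι ι ℂ :=
  V₂ * V₂ᴴ - (V₂ * V₁ᴴ) * ((V₁ * V₁ᴴ)⁻¹ * (V₁ * V₂ᴴ))

/-- Where the rows of `V₁` and `V₂` are orthonormal, the curvature of the quotient is the sum of a
second fundamental form term in the directions orthogonal to both families, and one in the directions
of `V₁`. -/
lemma chernCurvatureMat_schurGram (h₁ : MatHolAt V₁ z) (h₂ : MatHolAt V₂ z)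
    (h11 : V₁ z * (V₁ z)ᴴ = 1) (h21 : V₂ z * (V₁ z)ᴴ = 0) (h22 : V₂ z * (V₂ z)ᴴ = 1) :
    MatContDiffAt 2 (fun w => schurGram (V₁ w) (V₂ w)) z ∧ schurGram (V₁ z) (V₂ z) = 1 ∧
    chernCurvatureMat (fun w => schurGram (V₁ w) (V₂ w)) z u v =
      V₂ z * ((dMat V₁ z v)ᴴ * dMat V₁ z u - (dMat V₁ z u)ᴴ * dMat V₁ z v) * (V₂ z)ᴴ
      - (dMat V₂ z u * (1 - (V₁ z)ᴴ * V₁ z - (V₂ z)ᴴ * V₂ z) * (dMat V₂ z v)ᴴ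
        - dMat V₂ z v * (1 - (V₁ z)ᴴ * V₁ z - (V₂ z)ᴴ * V₂ z) * (dMat V₂ z u)ᴴ) := by
  have two : (2 : WithTop ℕ∞) ≠ 0 := two_ne_zero
  have h12 : V₁ z * (V₂ z)ᴴ = 0 := by
    rw [← Matrix.conjTranspose_conjTranspose (V₁ z), ← Matrix.conjTranspose_mul, h21,
      Matrix.conjTranspose_zero]
  have k1 := h₁.contDiffAt
  have k2 := h₂.contDiffAt
  have k1h := k1.conjTranspose
  have k2h := k2.conjTranspose
  have s22 := k2.mul k2h
  have s21 := k2.mul k1h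
  have s12 := k1.mul k2h
  have s11 := (k1.mul k1h).inv (by rw [h11, Matrix.det_one]; exact one_ne_zero)
  have sR := s11.mul s12
  have sS := s21.mul sR
  have s : MatContDiffAt 2 (fun w => schurGram (V₁ w) (V₂ w)) z := s22.sub sS
  have hz : schurGram (V₁ z) (V₂ z) = 1 := by
    rw [schurGram, h21, h22, Matrix.zero_mul, sub_zero]
  refine ⟨s, hz, ?_⟩
  have p22 : ∀ u, delMat (fun w => V₂ w * (V₂ w)ᴴ) z u = dMat V₂ z u * (V₂ z)ᴴ := fun u => by
    rw [delMat_mul (k2.matDiffAt two) (k2h.matDiffAt two), h₂.delMat, h₂.delMat_conjTranspose,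
      Matrix.mul_zero, add_zero]
  have q22 : ∀ u, delBarMat (fun w => V₂ w * (V₂ w)ᴴ) z u = V₂ z * (dMat V₂ z u)ᴴ := fun u => by
    rw [delBarMat_mul (k2.matDiffAt two) (k2h.matDiffAt two), h₂.delBarMat,
      h₂.delBarMat_conjTranspose, Matrix.zero_mul, zero_add]
  have p21 : ∀ u, delMat (fun w => V₂ w * (V₁ w)ᴴ) z u = dMat V₂ z u * (V₁ z)ᴴ := fun u => by
    rw [delMat_mul (k2.matDiffAt two) (k1h.matDiffAt two), h₂.delMat, h₁.delMat_conjTranspose,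
      Matrix.mul_zero, add_zero]
  have q21 : ∀ u, delBarMat (fun w => V₂ w * (V₁ w)ᴴ) z u = V₂ z * (dMat V₁ z u)ᴴ := fun u => by
    rw [delBarMat_mul (k2.matDiffAt two) (k1h.matDiffAt two), h₂.delBarMat,
      h₁.delBarMat_conjTranspose, Matrix.zero_mul, zero_add]
  have p12 : ∀ u, delMat (fun w => V₁ w * (V₂ w)ᴴ) z u = dMat V₁ z u * (V₂ z)ᴴ := fun u => by
    rw [delMat_mul (k1.matDiffAt two) (k2h.matDiffAt two), h₁.delMat, h₂.delMat_conjTranspose,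
      Matrix.mul_zero, add_zero]
  have q12 : ∀ u, delBarMat (fun w => V₁ w * (V₂ w)ᴴ) z u = V₁ z * (dMat V₂ z u)ᴴ := fun u => by
    rw [delBarMat_mul (k1.matDiffAt two) (k2h.matDiffAt two), h₁.delBarMat,
      h₂.delBarMat_conjTranspose, Matrix.zero_mul, zero_add]
  -- the factor `(V₁ V₁ᴴ)⁻¹` is not differentiated, as the two other factors vanish at `z`
  have pR : ∀ u, delMat (fun w => (V₁ w * (V₁ w)ᴴ)⁻¹ * (V₁ w * (V₂ w)ᴴ)) z u =
      dMat V₁ z u * (V₂ z)ᴴ := fun u => by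
    rw [delMat_mul (s11.matDiffAt two) (s12.matDiffAt two), h12, h11, p12, inv_one, Matrix.mul_zero,
      zero_add, Matrix.one_mul]
  have qR : ∀ u, delBarMat (fun w => (V₁ w * (V₁ w)ᴴ)⁻¹ * (V₁ w * (V₂ w)ᴴ)) z u =
      V₁ z * (dMat V₂ z u)ᴴ := fun u => by
    rw [delBarMat_mul (s11.matDiffAt two) (s12.matDiffAt two), h12, h11, q12, inv_one,
      Matrix.mul_zero, zero_add, Matrix.one_mul]
  have p : ∀ u, delMat (fun w => schurGram (V₁ w) (V₂ w)) z u = dMat V₂ z u * (V₂ z)ᴴ := fun u => by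
    simp only [schurGram]
    rw [delMat_sub (s22.matDiffAt two) (sS.matDiffAt two),
      delMat_mul (s21.matDiffAt two) (sR.matDiffAt two), h12, h21, p22]
    simp
  have q : ∀ u, delBarMat (fun w => schurGram (V₁ w) (V₂ w)) z u = V₂ z * (dMat V₂ z u)ᴴ :=
    fun u => by
      simp only [schurGram]
      rw [delBarMat_sub (s22.matDiffAt two) (sS.matDiffAt two),
        delBarMat_mul (s21.matDiffAt two) (sR.matDiffAt two), h12, h21, q22]
      simp
  have d : ddMat (fun w => schurGram (V₁ w) (V₂ w)) z u v =
      -(dMat V₂ z u * (dMat V₂ z v)ᴴ - dMat V₂ z v * (dMat V₂ z u)ᴴ)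
      - ((V₂ z * (dMat V₁ z u)ᴴ * (dMat V₁ z v * (V₂ z)ᴴ)
          - V₂ z * (dMat V₁ z v)ᴴ * (dMat V₁ z u * (V₂ z)ᴴ))
        - (dMat V₂ z u * (V₁ z)ᴴ * (V₁ z * (dMat V₂ z v)ᴴ)
          - dMat V₂ z v * (V₁ z)ᴴ * (V₁ z * (dMat V₂ z u)ᴴ))) := by
    simp only [schurGram]
    rw [ddMat_sub s22 sS, ddMat_mul k2 k2h, ddMat_mul s21 sR, h₂.ddMat, h₂.ddMat_conjTranspose,
      h₂.delBarMat, h₂.delBarMat, h₂.delMat, h₂.delMat, h₂.delBarMat_conjTranspose,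
      h₂.delBarMat_conjTranspose, h21, h12, p21, p21, q21, q21, pR, pR, qR, qR]
    simp
  rw [chernCurvatureMat_eq s (by rw [hz, Matrix.det_one]; exact one_ne_zero), hz, d]
  simp only [p, q, inv_one, Matrix.mul_one, Matrix.mul_sub,
    Matrix.sub_mul, Matrix.mul_assoc]
  abel

end ChernCurvature

namespace CompleteFlag

variable {n : ℕ}

/-! ### The charts of the flag manifold -/

/-- The matrix at which the preferred chart at the flag `x` is centred. -/
noncomputable def chartGL (x : CompleteFlag n) : GL (Fin n) ℂ := (exists_ofGL x).choose

lemma ofGL_chartGL (x : CompleteFlag n) : ofGL (chartGL x) = x := (exists_ofGL x).choose_spec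

lemma extChartAt_param (x : CompleteFlag n) (L : Model n) :
    extChartAt 𝓘(ℂ, Model n) x (param (chartGL x) L) = L :=
  Function.leftInverse_invFun (param_injective _) L

lemma param_chartGL_zero (x : CompleteFlag n) : param (chartGL x) 0 = x := by
  rw [param, lowerUniGL_zero, mul_one, ofGL_chartGL]

lemma extChartAt_self (x : CompleteFlag n) : extChartAt 𝓘(ℂ, Model n) x x = 0 := by
  have := extChartAt_param x 0
  rwa [param_chartGL_zero] at this

/-! ### Holomorphic frames -/

lemma contDiff_lowerUni (i j : Fin n) : ContDiff ℂ ω fun L : Model n => lowerUni L i j := by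
  simp only [lowerUni, Matrix.of_apply]
  split_ifs
  · exact contDiff_apply ℂ ℂ _
  · exact contDiff_const
  · exact contDiff_const

/-- The inverse is polynomial, as the determinant is `1`. -/
lemma contDiff_lowerUni_inv (i j : Fin n) :
    ContDiff ℂ ω fun L : Model n => (lowerUni L)⁻¹ i j := by
  simp only [Matrix.inv_def, det_lowerUni, Ring.inverse_one, one_smul]
  exact contDiff_adjugate contDiff_lowerUni i j

/-- The columns of `A U` over the points `U` of an affine chart centred at the flag of `A`: a
holomorphic frame of `E_l / E_k` over the whole chart domain. -/
theorem nonempty_holFrame (x : CompleteFlag n) (k l : Fin (n + 1)) : Nonempty (HolFrame x k l) := by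
  classical
  set A := chartGL x
  let B : CompleteFlag n → GL (Fin n) ℂ := fun y =>
    A * lowerUniGL (extChartAt 𝓘(ℂ, Model n) x y)
  have hB : ∀ y ∈ Set.range (param A), ofGL (B y) = y := by
    rintro _ ⟨L, rfl⟩
    simp only [B]
    rw [extChartAt_param]
    rfl
  have hmem : ∀ y ∈ Set.range (param A), ∀ a : BlockIdx k l, col (B y) a ∈ y.sub l := by
    intro y hy a
    have h1 : col (B y) a ∈ (ofGL (B y)).sub l := Submodule.subset_span ⟨a, a.2.2, rfl⟩
    rwa [hB y hy] at h1
  let sec : BlockIdx k l → ∀ y : CompleteFlag n, ↥(y.sub l) := fun a y =>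
    if hy : y ∈ Set.range (param A) then ⟨col (B y) a, hmem y hy a⟩ else 0
  have key : ∀ y ∈ Set.range (param A), ∃ C : GL (Fin n) ℂ, ∃ h : ofGL C = y,
      ∀ a, sec a y = ⟨col C a, by rw [← h]; exact Submodule.subset_span ⟨a, a.2.2, rfl⟩⟩ :=
    fun y hy => ⟨B y, hB y hy, fun a => dif_pos hy⟩
  refine ⟨⟨Set.range (param A), ?_, ?_, sec, ?_, ?_, ?_⟩⟩
  · exact (chartAt (Model n) x).open_source
  · exact ⟨0, param_chartGL_zero x⟩
  · intro a
    have h1 : ContMDiffOn 𝓘(ℂ, Model n) 𝓘(ℂ, EuclideanSpace ℂ (Fin n)) ω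
        (fun y => col (B y) a) (Set.range (param A)) := by
      have h2 : ContDiff ℂ ω fun L : Model n => col (A * lowerUniGL L) a.1 := by
        rw [contDiff_euclidean]
        intro i
        simp only [col, Units.val_mul, Matrix.mul_apply, coe_lowerUniGL]
        exact ContDiff.sum fun c _ => contDiff_const.mul (contDiff_lowerUni c a.1)
      exact h2.contMDiff.comp_contMDiffOn (contMDiffOn_extChartAt (x := x))
    exact h1.congr fun y hy => by simp only [sec, dif_pos hy]
  · intro y hy
    obtain ⟨C, rfl, hC⟩ := key y hy
    simp only [hC]
    exact linearIndependent_colClass C k l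
  · intro y hy
    obtain ⟨C, rfl, hC⟩ := key y hy
    simp only [hC]
    exact span_colClass C k l

/-! ### The differential of the projection `SU(n) → F(ℂ)` -/

lemma corr_apply_of_lt (M : Matrix (Fin n) (Fin n) ℂ) {i j : Fin n} (h : j < i) :
    corr M i j = 0 := by
  simp [corr, not_le.2 h]

/-- The differential of `U` is the strictly lower triangular matrix `U - 1`, as `U` is affine. -/
lemma dMat_lowerUni {E : Type*} [NormedAddCommGroup E] [NormedSpace ℝ E] {f : E → Model n} {z : E}
    (hf : DifferentiableAt ℝ f z) (u : E) :
    dMat (fun w => lowerUni (f w)) z u = lowerUni (fderiv ℝ f z u) - 1 := by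
  ext i j
  simp only [dMat, lowerUni, Matrix.of_apply, Matrix.sub_apply, Matrix.one_apply]
  split_ifs with h1 h2 h2
  · exact absurd h2 h1.ne'
  · rw [sub_zero, fderiv_apply hf]
    rfl
  · simp
  · simp

section
open scoped Matrix.Norms.Operator

lemma hasDerivAt_exp_smul_entry (X : Matrix (Fin n) (Fin n) ℂ) (i j : Fin n) (t : ℝ) :
    HasDerivAt (fun t : ℝ => NormedSpace.exp (t • X) i j) ((NormedSpace.exp (t • X) * X) i j) t :=
  hasDerivAt_pi.1 (hasDerivAt_pi.1 (hasDerivAt_exp_smul_const (𝕂 := ℝ) X t) i) j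

end

lemma contDiff_exp_smul_entry (X : Matrix (Fin n) (Fin n) ℂ) (i j : Fin n) :
    ContDiff ℝ 1 (fun t : ℝ => NormedSpace.exp (t • X) i j) := by
  rw [contDiff_one_iff_deriv]
  refine ⟨fun t => (hasDerivAt_exp_smul_entry X i j t).differentiableAt, ?_⟩
  rw [funext fun t => (hasDerivAt_exp_smul_entry X i j t).deriv]
  simp only [Matrix.mul_apply]
  refine continuous_finsetSum _ fun c _ => Continuous.mul ?_ continuous_const
  exact continuous_iff_continuousAt.2 fun t => (hasDerivAt_exp_smul_entry X i c t).continuousAt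

/-- In the chart centred at the flag of `A = g T`, with `T` upper triangular, the velocity `u` of
`t ↦ p(g exp(tX))` is determined by the entries of `T u T⁻¹` below the diagonal: they are those of
`X`. -/
lemma conj_lowerUni_pushforward (g : Matrix.specialUnitaryGroup (Fin n) ℂ) (X : su n)
    {i j : Fin n} (hij : j < i) :
    (((suToGL g)⁻¹ * chartGL (ofSU g)).1 * (lowerUni (pushforward g X) - 1) *
      ((chartGL (ofSU g))⁻¹ * suToGL g).1) i j = X.1 i j := by
  set A := chartGL (ofSU g) with hA
  set G := suToGL g with hG
  have hAG : ofGL A = ofGL G := ofGL_chartGL _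
  -- the curve in the affine chart is the lower unitriangular factor of `R t`
  let R : ℝ → Matrix (Fin n) (Fin n) ℂ := fun t => (A⁻¹ * (G * expGL (t • X.1))).1
  have hRt : ∀ t, R t = (A⁻¹ * G).1 * NormedSpace.exp (t • X.1) := fun t => by
    simp only [R]
    rw [← mul_assoc, Units.val_mul]
    rfl
  have hR0 : R 0 = (A⁻¹ * G).1 := by rw [hRt, zero_smul, NormedSpace.exp_zero, mul_one]
  have hexp : MatContDiffAt 1 (fun t : ℝ => NormedSpace.exp (t • X.1)) 0 := fun i j =>
    (contDiff_exp_smul_entry X.1 i j).contDiffAt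
  have hdexp : dMat (fun t : ℝ => NormedSpace.exp (t • X.1)) 0 1 = X.1 := by
    ext i j
    have h1 := (hasDerivAt_exp_smul_entry X.1 i j 0).deriv
    rw [zero_smul, NormedSpace.exp_zero, one_mul] at h1
    exact h1
  have hconst : ∀ C : Matrix (Fin n) (Fin n) ℂ, MatContDiffAt 1 (fun _ : ℝ => C) 0 :=
    fun C i j => contDiffAt_const
  have hR : MatContDiffAt 1 R 0 := by
    rw [funext hRt]
    exact (hconst _).mul hexp
  have hdR : dMat R 0 1 = (A⁻¹ * G).1 * X.1 := by
    rw [funext hRt, dMat_mul ((hconst _).matDiffAt one_ne_zero) (hexp.matDiffAt one_ne_zero),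
      dMat_const, hdexp, zero_mul, zero_add]
  have hdet0 : ∀ b, (lead (R 0) b).det ≠ 0 := by
    rw [hR0]
    refine (ofGL_mem_range_iff A G).1 ⟨0, ?_⟩
    rw [param, lowerUniGL_zero, mul_one, hAG]
  have hlead : ∀ b, MatContDiffAt 1 (fun t => lead (R t) b) 0 := fun b i j => hR i j
  have hdet : ∀ᶠ t in nhds 0, ∀ b, (lead (R t) b).det ≠ 0 :=
    Filter.eventually_all.2 fun b => (hlead b).det_ne_zero_eventually (hdet0 b)
  have hcorr : MatContDiffAt 1 (fun t => corr (R t)) 0 := by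
    intro c b
    simp only [corr, Matrix.of_apply]
    split_ifs with h
    · exact (hlead b).inv (hdet0 b) _ _
    · exact contDiffAt_const
  let ℓ : ℝ → Model n := fun t => lowerPart (R t)
  have hℓ : DifferentiableAt ℝ ℓ 0 := differentiableAt_pi.2 fun p =>
    ((hR.mul hcorr).matDiffAt one_ne_zero) p.1.1 p.1.2
  have hpush : pushforward g X = fderiv ℝ ℓ 0 1 := by
    have h1 : (fun t : ℝ => extChartAt 𝓘(ℂ, Model n) (ofSU g) (ofGL (G * expGL (t • X.1))))
        =ᶠ[nhds 0] ℓ := by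
      filter_upwards [hdet] with t ht
      rw [← param_lowerPart A _ ht]
      exact extChartAt_param (ofSU g) _
    exact h1.deriv_eq
  have hU : (fun t => R t * corr (R t)) =ᶠ[nhds 0] fun t => lowerUni (ℓ t) :=
    hdet.mono fun t ht => mul_corr ht
  have hℓ0 : ℓ 0 = 0 := by
    apply param_injective A
    simp only [ℓ]
    rw [hR0, param_lowerPart A G (by rw [← hR0]; exact hdet0), ← hAG, param, lowerUniGL_zero,
      mul_one]
  have hTT : (G⁻¹ * A).1 * (A⁻¹ * G).1 = 1 := by
    rw [← Units.val_mul]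
    simp
  have hC0 : corr (R 0) = (G⁻¹ * A).1 := by
    have h1 : R 0 * corr (R 0) = lowerUni (ℓ 0) := hU.self_of_nhds
    rw [hℓ0, ← coe_lowerUniGL, lowerUniGL_zero, Units.val_one, hR0] at h1
    calc corr (R 0) = (G⁻¹ * A).1 * ((A⁻¹ * G).1 * corr (A⁻¹ * G).1) := by
          rw [← mul_assoc, hTT, one_mul, hR0]
      _ = _ := by rw [h1, mul_one]
  set D := dMat (fun t => corr (R t)) 0 1 with hD
  have hd : lowerUni (pushforward g X) - 1 =
      (A⁻¹ * G).1 * X.1 * (G⁻¹ * A).1 + (A⁻¹ * G).1 * D := by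
    rw [hpush, ← dMat_lowerUni hℓ, ← dMat_congr hU,
      dMat_mul (hR.matDiffAt one_ne_zero) (hcorr.matDiffAt one_ne_zero), hdR, hC0, hR0]
  -- `D` and `A⁻¹ G` are upper triangular, so their product does not contribute below the diagonal
  have hDup : ∀ i j : Fin n, j < i → D i j = 0 := fun i j h => by
    rw [hD]
    simp only [dMat, Matrix.of_apply, corr_apply_of_lt _ h]
    simp
  have hfin : (G⁻¹ * A).1 * (lowerUni (pushforward g X) - 1) * (A⁻¹ * G).1 =
      X.1 + D * (A⁻¹ * G).1 := by
    rw [hd, mul_add, add_mul]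
    congr 1
    · rw [← mul_assoc, ← mul_assoc, hTT, one_mul, mul_assoc, hTT, mul_one]
    · rw [← mul_assoc, hTT, one_mul]
  rw [hfin, Matrix.add_apply, Matrix.mul_apply, Finset.sum_eq_zero, add_zero]
  intro c _
  rcases lt_or_ge c i with h | h
  · rw [hDup i c h, zero_mul]
  · rw [upper_of_ofGL_eq hAG (lt_of_lt_of_le hij h), mul_zero]


/-! ### Gram matrices of the quotient metric -/

/-- The rows with index `i < k`. -/
def firstRows (k : Fin (n + 1)) (V : Matrix (Fin n) (Fin n) ℂ) :
    Matrix {i : Fin n // i.castSucc < k} (Fin n) ℂ := V.submatrix Subtype.val id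

/-- The rows with index `k ≤ a < l`. -/
def blockRows (k l : Fin (n + 1)) (V : Matrix (Fin n) (Fin n) ℂ) :
    Matrix (BlockIdx k l) (Fin n) ℂ := V.submatrix Subtype.val id

lemma inner_col (B : GL (Fin n) ℂ) (i j : Fin n) :
    inner ℂ (col B j) (col B i) = (B.1ᵀ * B.1ᵀᴴ) i j := by
  rw [EuclideanSpace.inner_eq_star_dotProduct, Matrix.mul_apply]
  rfl

/-- The projection of a column to `E_kᗮ` by the normal equations: the coefficients of its component in
`E_k` are `V₂ V₁ᴴ (V₁ V₁ᴴ)⁻¹`. -/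
lemma starProjection_col (B : GL (Fin n) ℂ) (k l : Fin (n + 1))
    (hdet : (firstRows k B.1ᵀ * (firstRows k B.1ᵀ)ᴴ).det ≠ 0) (a : BlockIdx k l) :
    (colSpan B k)ᗮ.starProjection (col B a) = col B a - ∑ i : {i : Fin n // i.castSucc < k},
      (blockRows k l B.1ᵀ * (firstRows k B.1ᵀ)ᴴ * (firstRows k B.1ᵀ * (firstRows k B.1ᵀ)ᴴ)⁻¹) a i •
        col B i := by
  set V₁ := firstRows k B.1ᵀ with hV₁
  set V₂ := blockRows k l B.1ᵀ with hV₂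
  have hmem : ∀ i : {i : Fin n // i.castSucc < k}, col B i ∈ colSpan B k := fun i =>
    Submodule.subset_span ⟨i, i.2, rfl⟩
  refine Submodule.eq_starProjection_of_mem_orthogonal ?_ ?_
  · set w := col B a - ∑ i : {i : Fin n // i.castSucc < k},
      (V₂ * V₁ᴴ * (V₁ * V₁ᴴ)⁻¹) a i • col B i with hw
    suffices h : colSpan B k ≤ (ℂ ∙ w)ᗮ from fun u hu =>
      Submodule.mem_orthogonal_singleton_iff_inner_left.1 (h hu)
    refine Submodule.span_le.2 ?_
    rintro _ ⟨j, hj, rfl⟩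
    refine Submodule.mem_orthogonal_singleton_iff_inner_left.2 ?_
    have h1 : V₂ * V₁ᴴ * (V₁ * V₁ᴴ)⁻¹ * (V₁ * V₁ᴴ) = V₂ * V₁ᴴ := by
      rw [Matrix.mul_assoc, Matrix.nonsing_inv_mul _ (isUnit_iff_ne_zero.2 hdet), Matrix.mul_one]
    have h2 : inner ℂ (col B j) (col B a) = (V₂ * V₁ᴴ) a ⟨j, hj⟩ := inner_col B a j
    have h3 : ∀ i : {i : Fin n // i.castSucc < k},
        inner ℂ (col B j) (col B i) = (V₁ * V₁ᴴ) i ⟨j, hj⟩ := fun i => inner_col B i j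
    rw [hw, inner_sub_right, inner_sum, h2]
    simp only [inner_smul_right, h3]
    rw [← Matrix.mul_apply, h1, sub_self]
  · rw [sub_sub_cancel]
    exact Submodule.le_orthogonal_orthogonal _
      (Submodule.sum_mem _ fun i _ => Submodule.smul_mem _ _ (hmem i))

/-- The Gram matrix of the columns of `B` for the metric of the quotient by the first columns. -/
lemma inner_starProjection_col (B : GL (Fin n) ℂ) (k l : Fin (n + 1))
    (hdet : (firstRows k B.1ᵀ * (firstRows k B.1ᵀ)ᴴ).det ≠ 0) (a b : BlockIdx k l) :
    inner ℂ ((colSpan B k)ᗮ.starProjection (col B b)) ((colSpan B k)ᗮ.starProjection (col B a)) =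
      schurGram (firstRows k B.1ᵀ) (blockRows k l B.1ᵀ) a b := by
  rw [Submodule.inner_starProjection_left_eq_right,
    Submodule.starProjection_eq_self_iff.2 (Submodule.starProjection_apply_mem _ _),
    starProjection_col B k l hdet, inner_sub_right, inner_sum, schurGram, ← Matrix.mul_assoc,
    Matrix.sub_apply, inner_col, Matrix.mul_apply (M := _ * _ * _)]
  congr 1
  refine Finset.sum_congr rfl fun i _ => ?_
  rw [inner_smul_right, inner_col]
  rfl

/-- The coordinates modulo `E_k` of vectors in `E_l`, in the columns of `B`. -/
noncomputable def blockCoord (B : GL (Fin n) ℂ) (k l : Fin (n + 1))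
    (v : BlockIdx k l → EuclideanSpace ℂ (Fin n)) : Matrix (BlockIdx k l) (BlockIdx k l) ℂ :=
  Matrix.of fun a b => ((B⁻¹).1 *ᵥ (v a).ofLp) b

lemma starProjection_eq_sum_blockCoord (B : GL (Fin n) ℂ) (k l : Fin (n + 1))
    (v : BlockIdx k l → EuclideanSpace ℂ (Fin n)) (hv : ∀ a, v a ∈ colSpan B l)
    (a : BlockIdx k l) : (colSpan B k)ᗮ.starProjection (v a) =
      ∑ b, blockCoord B k l v a b • (colSpan B k)ᗮ.starProjection (col B b) := by
  simp only [← map_smul, ← map_sum]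
  rw [← sub_eq_zero, ← map_sub, Submodule.starProjection_apply_eq_zero_iff]
  refine Submodule.le_orthogonal_orthogonal _ ((mem_colSpan_repr B k _).2 fun i hi => ?_)
  rw [map_sub, Finsupp.sub_apply, sum_repr B k l (fun b => blockCoord B k l v a b) i]
  split_ifs with h
  · rw [colBasis_repr]
    exact sub_self _
  · rw [sub_zero]
    exact (mem_colSpan_repr B l _).1 (hv a) i (not_lt.1 fun hl => h ⟨hi, hl⟩)

/-- The quotient metric on vectors of `E_l`, which is determined by their coordinates modulo `E_k`. -/
lemma inner_starProjection_eq (B : GL (Fin n) ℂ) (k l : Fin (n + 1))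
    (hdet : (firstRows k B.1ᵀ * (firstRows k B.1ᵀ)ᴴ).det ≠ 0)
    (v : BlockIdx k l → EuclideanSpace ℂ (Fin n)) (hv : ∀ a, v a ∈ colSpan B l)
    (a b : BlockIdx k l) :
    inner ℂ ((colSpan B k)ᗮ.starProjection (v b)) ((colSpan B k)ᗮ.starProjection (v a)) =
      (blockCoord B k l v * (schurGram (firstRows k B.1ᵀ) (blockRows k l B.1ᵀ) *
        (blockCoord B k l v)ᴴ)) a b := by
  rw [starProjection_eq_sum_blockCoord B k l v hv a, starProjection_eq_sum_blockCoord B k l v hv b,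
    inner_sum, Matrix.mul_apply]
  refine Finset.sum_congr rfl fun c _ => ?_
  rw [inner_smul_right, sum_inner, Matrix.mul_apply]
  congr 1
  refine Finset.sum_congr rfl fun d _ => ?_
  rw [inner_smul_left, inner_starProjection_col B k l hdet, mul_comm]
  rfl

lemma schurGram_mul_unitary {κ ι ν : Type*} [Fintype κ] [DecidableEq κ] [Fintype ι] [Fintype ν]
    [DecidableEq ν] (V₁ : Matrix κ ν ℂ) (V₂ : Matrix ι ν ℂ) {U : Matrix ν ν ℂ} (hU : U * Uᴴ = 1) :
    schurGram (V₁ * U) (V₂ * U) = schurGram V₁ V₂ := by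
  simp only [schurGram, Matrix.conjTranspose_mul, Matrix.mul_assoc, ← Matrix.mul_assoc U, hU,
    Matrix.one_mul]


/-! ### The tautological frame translated along a chart -/

/-- A lift to `GL_n(ℂ)` of the parametrization `param A`, provided `A` and `G` have the same flag; its
value at the origin is `G`. -/
noncomputable def chartLift (A G : GL (Fin n) ℂ) (L : Model n) : GL (Fin n) ℂ :=
  A * lowerUniGL L * (A⁻¹ * G)

/-- The coordinates of the columns of `chartLift A G L` in the columns of `G`. -/
noncomputable def liftCoord (A G : GL (Fin n) ℂ) (L : Model n) : Matrix (Fin n) (Fin n) ℂ :=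
  (G⁻¹ * A).1 * lowerUni L * (A⁻¹ * G).1

lemma chartLift_zero (A G : GL (Fin n) ℂ) : chartLift A G 0 = G := by
  rw [chartLift, lowerUniGL_zero]
  group

lemma ofGL_chartLift {A G : GL (Fin n) ℂ} (h : ofGL A = ofGL G) (L : Model n) :
    ofGL (chartLift A G L) = param A L := by
  refine ofGL_eq_of_upper fun i j hij => ?_
  rw [show (chartLift A G L)⁻¹ * (A * lowerUniGL L) = G⁻¹ * A by rw [chartLift]; group]
  exact upper_of_ofGL_eq h.symm hij

lemma coe_chartLift (A G : GL (Fin n) ℂ) (L : Model n) :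
    (chartLift A G L).1 = G.1 * liftCoord A G L := by
  rw [liftCoord, ← mul_assoc, ← mul_assoc, ← Units.val_mul, ← coe_lowerUniGL, ← Units.val_mul,
    ← Units.val_mul, chartLift]
  congr 1
  group

lemma coe_chartLift_inv (A G : GL (Fin n) ℂ) (L : Model n) :
    ((chartLift A G L)⁻¹).1 = (G⁻¹ * A).1 * (lowerUni L)⁻¹ * (A⁻¹).1 := by
  rw [← coe_lowerUniGL, ← Matrix.coe_units_inv, ← Units.val_mul, ← Units.val_mul, chartLift]
  congr 1
  group

lemma liftCoord_zero (A G : GL (Fin n) ℂ) : liftCoord A G 0 = 1 := by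
  rw [liftCoord, ← coe_lowerUniGL, lowerUniGL_zero, Units.val_one, mul_one, ← Units.val_mul]
  simp

lemma contDiff_liftCoord (A G : GL (Fin n) ℂ) (i j : Fin n) :
    ContDiff ℂ ω fun L : Model n => liftCoord A G L i j := by
  simp only [liftCoord, Matrix.mul_apply]
  exact ContDiff.sum fun c _ => (ContDiff.sum fun d _ =>
    contDiff_const.mul (contDiff_lowerUni d c)).mul contDiff_const

lemma dMat_liftCoord (A G : GL (Fin n) ℂ) (u : Model n) :
    dMat (liftCoord A G) 0 u = (G⁻¹ * A).1 * (lowerUni u - 1) * (A⁻¹ * G).1 := by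
  have hU : MatDiffAt (fun L : Model n => lowerUni L) 0 := fun i j =>
    (((contDiff_lowerUni i j).differentiable (by simp)).differentiableAt).restrictScalars ℝ
  have hC : ∀ C : Matrix (Fin n) (Fin n) ℂ, MatDiffAt (fun _ : Model n => C) 0 :=
    fun C i j => differentiableAt_const _
  have h1 := dMat_lowerUni (f := fun L : Model n => L) (z := 0) differentiableAt_id u
  rw [fderiv_fun_id, ContinuousLinearMap.id_apply] at h1
  unfold liftCoord
  rw [dMat_mul ((hC _).mul hU) (hC _), dMat_mul (hC _) hU, dMat_const, dMat_const, h1]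
  simp

/-- The Gram matrix of the frame of `E_l / E_k` given by the columns of `chartLift A G`. -/
noncomputable def tautGram (A G : GL (Fin n) ℂ) (k l : Fin (n + 1)) (L : Model n) :
    Matrix (BlockIdx k l) (BlockIdx k l) ℂ :=
  schurGram (firstRows k (liftCoord A G L)ᵀ) (blockRows k l (liftCoord A G L)ᵀ)

/-- The curvature matrix of the tautological frame in terms of the differential of its
coordinates. -/
lemma chernCurvatureMat_tautGram (A G : GL (Fin n) ℂ) (k l : Fin (n + 1)) (hkl : k ≤ l)
    (u v : Model n) :
    MatContDiffAt 2 (tautGram A G k l) 0 ∧ tautGram A G k l 0 = 1 ∧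
    ∀ a b, chernCurvatureMat (tautGram A G k l) 0 u v a b =
      (∑ i : Fin n with i.castSucc < k,
        (dMat (liftCoord A G) 0 u b i * star (dMat (liftCoord A G) 0 v a i) -
          dMat (liftCoord A G) 0 v b i * star (dMat (liftCoord A G) 0 u a i))) -
      ∑ j : Fin n with l ≤ j.castSucc,
        (dMat (liftCoord A G) 0 u j a * star (dMat (liftCoord A G) 0 v j b) -
          dMat (liftCoord A G) 0 v j a * star (dMat (liftCoord A G) 0 u j b)) := by
  classical
  have h₁ : MatHolAt (fun L => firstRows k (liftCoord A G L)ᵀ) 0 :=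
    MatHolAt.of_contDiffAt fun i m => (contDiff_liftCoord A G m i).contDiffAt
  have h₂ : MatHolAt (fun L => blockRows k l (liftCoord A G L)ᵀ) 0 :=
    MatHolAt.of_contDiffAt fun a m => (contDiff_liftCoord A G m a).contDiffAt
  have e1 : ∀ i m, firstRows k (1 : Matrix (Fin n) (Fin n) ℂ) i m = if i.1 = m then 1 else 0 :=
    fun i m => Matrix.one_apply
  have e2 : ∀ a m, blockRows k l (1 : Matrix (Fin n) (Fin n) ℂ) a m = if a.1 = m then 1 else 0 :=
    fun a m => Matrix.one_apply
  have h11 : firstRows k (1 : Matrix (Fin n) (Fin n) ℂ) * (firstRows k 1)ᴴ = 1 := by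
    ext i j
    simp [Matrix.mul_apply, e1, Matrix.one_apply, Subtype.ext_iff, eq_comm]
  have h21 : blockRows k l (1 : Matrix (Fin n) (Fin n) ℂ) * (firstRows k 1)ᴴ = 0 := by
    ext a i
    have : a.1 ≠ i.1 := fun h => absurd i.2 (not_lt.2 (h ▸ a.2.1))
    simp [Matrix.mul_apply, e1, e2, this]
  have h22 : blockRows k l (1 : Matrix (Fin n) (Fin n) ℂ) * (blockRows k l 1)ᴴ = 1 := by
    ext i j
    simp [Matrix.mul_apply, e2, Matrix.one_apply, Subtype.ext_iff, eq_comm]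
  -- the projection to the complement of `E_l`
  have hQ : (1 : Matrix (Fin n) (Fin n) ℂ) - (firstRows k 1)ᴴ * firstRows k 1
      - (blockRows k l 1)ᴴ * blockRows k l 1 =
      Matrix.diagonal fun m => if l ≤ m.castSucc then 1 else 0 := by
    ext m m'
    have f1 : ((firstRows k (1 : Matrix (Fin n) (Fin n) ℂ))ᴴ * firstRows k 1) m m' =
        if m = m' then if m.castSucc < k then 1 else 0 else 0 := by
      simp only [Matrix.mul_apply, Matrix.conjTranspose_apply, e1]
      rw [← Finset.sum_subtype (Finset.univ.filter fun i : Fin n => i.castSucc < k) (by simp)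
        (fun i => star (if i = m then (1 : ℂ) else 0) * if i = m' then 1 else 0), Finset.sum_filter,
        Finset.sum_eq_single m (fun b _ hb => by simp [hb]) (by simp)]
      split_ifs <;> (simp; try contradiction)
    have f2 : ((blockRows k l (1 : Matrix (Fin n) (Fin n) ℂ))ᴴ * blockRows k l 1) m m' =
        if m = m' then if k ≤ m.castSucc ∧ m.castSucc < l then 1 else 0 else 0 := by
      simp only [Matrix.mul_apply, Matrix.conjTranspose_apply, e2]
      rw [← Finset.sum_subtype
        (Finset.univ.filter fun i : Fin n => k ≤ i.castSucc ∧ i.castSucc < l) (by simp)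
        (fun i => star (if i = m then (1 : ℂ) else 0) * if i = m' then 1 else 0), Finset.sum_filter,
        Finset.sum_eq_single m (fun b _ hb => by simp [hb]) (by simp)]
      split_ifs <;> (simp; try contradiction)
    rw [Matrix.sub_apply, Matrix.sub_apply, f1, f2, Matrix.one_apply, Matrix.diagonal_apply]
    by_cases hm : m = m'
    · rcases lt_or_ge m.castSucc k with hk | hk
      · simp [hm ▸ hk, hm ▸ not_le.2 hk, hm ▸ not_le.2 (hk.trans_le hkl), hm]
      · rcases lt_or_ge m.castSucc l with hl | hl
        · simp [hm ▸ hk, hm ▸ hl, hm ▸ not_le.2 hl, hm ▸ not_lt.2 hk, hm]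
        · simp [hm ▸ hl, hm ▸ not_lt.2 hl, hm ▸ not_lt.2 hk, hm]
    · simp [hm]
  obtain ⟨c1, c2, c3⟩ := chernCurvatureMat_schurGram (u := u) (v := v) h₁ h₂
    (by simp only [liftCoord_zero, Matrix.transpose_one, h11])
    (by simp only [liftCoord_zero, Matrix.transpose_one, h21])
    (by simp only [liftCoord_zero, Matrix.transpose_one, h22])
  refine ⟨c1, c2, fun a b => ?_⟩
  refine (congrFun (congrFun c3 a) b).trans ?_
  simp only [liftCoord_zero, Matrix.transpose_one, hQ]
  set N := dMat (liftCoord A G) 0 with hN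
  have d1 : ∀ u i m, dMat (fun L => firstRows k (liftCoord A G L)ᵀ) 0 u i m = N u m i :=
    fun u i m => rfl
  have d2 : ∀ u a m, dMat (fun L => blockRows k l (liftCoord A G L)ᵀ) 0 u a m = N u m a :=
    fun u i m => rfl
  have s1 : ∀ Z : Matrix (Fin n) (Fin n) ℂ, (blockRows k l (1 : Matrix (Fin n) (Fin n) ℂ) * Z *
      (blockRows k l (1 : Matrix (Fin n) (Fin n) ℂ))ᴴ) a b = Z a b := fun Z => by
    simp [Matrix.mul_apply, e2]
  rw [Matrix.sub_apply, s1, Matrix.sub_apply, Matrix.sub_apply]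
  congr 1
  · rw [Finset.sum_sub_distrib]
    simp only [Matrix.mul_apply, Matrix.conjTranspose_apply, d1]
    congr 1
    · rw [Finset.sum_subtype (Finset.univ.filter fun i : Fin n => i.castSucc < k)
        (p := fun i => i.castSucc < k) (by simp)]
      exact Finset.sum_congr rfl fun i _ => mul_comm _ _
    · rw [Finset.sum_subtype (Finset.univ.filter fun i : Fin n => i.castSucc < k)
        (p := fun i => i.castSucc < k) (by simp)]
      exact Finset.sum_congr rfl fun i _ => mul_comm _ _
  · rw [Finset.sum_sub_distrib]
    simp only [Matrix.mul_apply (M := _ * _), Matrix.mul_diagonal, Matrix.conjTranspose_apply, d2]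
    congr 1 <;>
    · rw [Finset.sum_filter]
      refine Finset.sum_congr rfl fun j _ => ?_
      split_ifs <;> simp


/-! ### The curvature of an arbitrary holomorphic frame -/

lemma mk_eq_sum_blockCoord (B : GL (Fin n) ℂ) (k l : Fin (n + 1))
    (v : BlockIdx k l → ↥((ofGL B).sub l)) (a : BlockIdx k l) :
    (Submodule.Quotient.mk (v a) : QuotFiber (ofGL B) k l) =
      ∑ b, blockCoord B k l (fun a => v a) a b • colClass B k l b := by
  have h2 : ∀ c : BlockIdx k l → ℂ, ∑ b, c b • colClass B k l b =
      (Submodule.Quotient.mk (∑ b, c b •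
        (⟨col B b, Submodule.subset_span ⟨b, b.2.2, rfl⟩⟩ : ↥((ofGL B).sub l))) :
        QuotFiber (ofGL B) k l) := fun c => by
    change _ = Submodule.mkQ _ _
    rw [map_sum]
    rfl
  rw [h2, Submodule.Quotient.eq, Submodule.submoduleOf, Submodule.mem_comap]
  refine (mem_colSpan_repr B k _).2 fun i hi => ?_
  rw [map_sub, map_sum, map_sub, Finsupp.sub_apply]
  have h3 := sum_repr B k l (fun b => blockCoord B k l (fun a => v a) a b) i
  refine (congrArg _ h3).trans ?_
  split_ifs with h
  · refine sub_eq_zero.2 ?_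
    exact colBasis_repr B _ i
  · rw [sub_zero]
    exact (mem_colSpan_repr B l _).1 (v a).2 i (not_lt.1 fun hl => h ⟨hi, hl⟩)

/-- The unitary frame `([g_a])` of `E_l / E_k` at the flag of `g`. -/
noncomputable def unitaryFrame (g : Matrix.specialUnitaryGroup (Fin n) ℂ) (k l : Fin (n + 1)) :
    Module.Basis (BlockIdx k l) ℂ (QuotFiber (ofSU g) k l) :=
  colClassBasis (suToGL g) k l

lemma unitaryFrame_apply (g : Matrix.specialUnitaryGroup (Fin n) ℂ) (k l : Fin (n + 1))
    (a : BlockIdx k l) : unitaryFrame g k l a = colClass (suToGL g) k l a :=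
  Module.Basis.mk_apply (linearIndependent_colClass (suToGL g) k l)
    (span_colClass (suToGL g) k l) a

namespace HolFrame

variable {x : CompleteFlag n} {k l : Fin (n + 1)} (s : HolFrame x k l)

lemma gram_eq (B : GL (Fin n) ℂ) (y : CompleteFlag n) (hB : ofGL B = y)
    (hdet : (firstRows k B.1ᵀ * (firstRows k B.1ᵀ)ᴴ).det ≠ 0) :
    s.gram y = blockCoord B k l (fun a => s.sec a y) *
      (schurGram (firstRows k B.1ᵀ) (blockRows k l B.1ᵀ) *
        (blockCoord B k l (fun a => s.sec a y))ᴴ) := by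
  subst hB
  ext a b
  exact inner_starProjection_eq B k l hdet (fun a => s.sec a (ofGL B))
    (fun a => (s.sec a (ofGL B)).2) a b

/-- The sections of a holomorphic frame, read in the chart. -/
lemma contDiffAt_sec (a : BlockIdx k l) : ContDiffAt ℂ ω
    (fun L => (s.sec a (param (chartGL x) L) : EuclideanSpace ℂ (Fin n))) 0 := by
  rw [← contMDiffAt_iff_contDiffAt]
  have h1 : ContMDiffAt 𝓘(ℂ, Model n) 𝓘(ℂ, EuclideanSpace ℂ (Fin n)) ω
      (fun y => (s.sec a y : EuclideanSpace ℂ (Fin n))) x :=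
    (s.holomorphic a).contMDiffAt (s.isOpen_dom.mem_nhds s.mem_dom)
  have h2 : ContMDiffAt 𝓘(ℂ, Model n) 𝓘(ℂ, Model n) ω
      (extChartAt 𝓘(ℂ, Model n) x).symm 0 := by
    refine (contMDiffOn_extChartAt_symm x).contMDiffAt ?_
    have := extChartAt_target_mem_nhds (I := 𝓘(ℂ, Model n)) x
    rwa [extChartAt_self] at this
  exact ContMDiffAt.comp_of_eq (x := (0 : Model n)) h1 h2 (param_chartGL_zero x)

/-- The change of frame from the columns of `chartLift` to the frame `s`, in the chart. -/
noncomputable def transition (G : GL (Fin n) ℂ) (L : Model n) :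
    Matrix (BlockIdx k l) (BlockIdx k l) ℂ :=
  blockCoord (chartLift (chartGL x) G L) k l (fun a => s.sec a (param (chartGL x) L))

lemma matHolAt_transition (G : GL (Fin n) ℂ) : MatHolAt (s.transition G) 0 := by
  refine MatHolAt.of_contDiffAt fun a b => ?_
  simp only [transition, blockCoord, Matrix.of_apply, Matrix.mulVec, dotProduct,
    coe_chartLift_inv]
  refine ContDiffAt.sum fun c _ => ContDiffAt.mul ?_ ?_
  · simp only [Matrix.mul_apply]
    exact (ContDiff.sum fun e _ => (ContDiff.sum fun d _ =>
      contDiff_const.mul (contDiff_lowerUni_inv d e)).mul contDiff_const).contDiffAt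
  · exact contDiffAt_euclidean.1 (s.contDiffAt_sec a) c

/-- Near the origin of the chart, the Gram matrix of `s` is `M H₀ Mᴴ` with `H₀` that of the tautological
frame and `M` holomorphic. -/
lemma gramInChart_eventuallyEq (g : Matrix.specialUnitaryGroup (Fin n) ℂ)
    (s : HolFrame (ofSU g) k l) :
    s.gramInChart =ᶠ[nhds 0] fun L => s.transition (suToGL g) L *
      (tautGram (chartGL (ofSU g)) (suToGL g) k l L * (s.transition (suToGL g) L)ᴴ) := by
  classical
  set A := chartGL (ofSU g) with hA
  set G := suToGL g with hG
  have hAG : ofGL A = ofGL G := ofGL_chartGL _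
  have hU : G.1ᵀ * (G.1ᵀ)ᴴ = 1 := by
    have h1 : star g.1 * g.1 = 1 := Matrix.mem_unitaryGroup_iff'.1 g.2.1
    have h2 := congrArg Matrix.transpose h1
    rw [Matrix.transpose_mul, Matrix.transpose_one] at h2
    exact h2
  have hT : ∀ L, (chartLift A G L).1ᵀ = (liftCoord A G L)ᵀ * G.1ᵀ := fun L => by
    rw [coe_chartLift, Matrix.transpose_mul]
  have hf : ∀ L, firstRows k (chartLift A G L).1ᵀ = firstRows k (liftCoord A G L)ᵀ * G.1ᵀ :=
    fun L => by rw [hT]; rfl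
  have hb : ∀ L, blockRows k l (chartLift A G L).1ᵀ = blockRows k l (liftCoord A G L)ᵀ * G.1ᵀ :=
    fun L => by rw [hT]; rfl
  have hV : MatContDiffAt 2 (fun L => firstRows k (chartLift A G L).1ᵀ) 0 := by
    refine (MatHolAt.of_contDiffAt fun i m => ?_).contDiffAt
    simp only [hf, Matrix.mul_apply]
    exact ContDiffAt.sum fun c _ => (contDiff_liftCoord A G c i).contDiffAt.mul contDiffAt_const
  have hdet0 : (firstRows k (chartLift A G 0).1ᵀ * (firstRows k (chartLift A G 0).1ᵀ)ᴴ).det ≠ 0 := by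
    have h1 : firstRows k (1 : Matrix (Fin n) (Fin n) ℂ) * (firstRows k 1)ᴴ = 1 := by
      ext i j
      simp [Matrix.mul_apply, firstRows, Matrix.one_apply, Subtype.ext_iff, eq_comm]
    rw [hf, Matrix.conjTranspose_mul, Matrix.mul_assoc, ← Matrix.mul_assoc G.1ᵀ, hU, Matrix.one_mul,
      liftCoord_zero, Matrix.transpose_one, h1, Matrix.det_one]
    exact one_ne_zero
  filter_upwards [(hV.mul hV.conjTranspose).det_ne_zero_eventually hdet0] with L hL
  rw [tautGram, ← schurGram_mul_unitary _ _ hU, ← hf, ← hb]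
  exact s.gram_eq (chartLift A G L) _ (ofGL_chartLift hAG L) hL

lemma basis_eq_sum (g : Matrix.specialUnitaryGroup (Fin n) ℂ) (s : HolFrame (ofSU g) k l)
    (a : BlockIdx k l) : s.basis a =
      ∑ b, s.transition (suToGL g) 0 a b • unitaryFrame g k l b := by
  have h1 : s.transition (suToGL g) 0 =
      blockCoord (suToGL g) k l (fun a => s.sec a (ofSU g)) := by
    rw [transition, chartLift_zero, param_chartGL_zero]
  rw [h1]
  simp only [basis, Module.Basis.mk_apply, unitaryFrame_apply]
  exact mk_eq_sum_blockCoord (suToGL g) k l (fun a => s.sec a (ofSU g)) a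

lemma det_transition_ne_zero (g : Matrix.specialUnitaryGroup (Fin n) ℂ)
    (s : HolFrame (ofSU g) k l) : (s.transition (suToGL g) 0).det ≠ 0 := by
  classical
  have h1 : ((unitaryFrame g k l).toMatrix s.basis)ᵀ = s.transition (suToGL g) 0 := by
    ext a b
    rw [Matrix.transpose_apply, Module.Basis.toMatrix_apply, basis_eq_sum]
    simp [Finsupp.single_apply]
  rw [← h1, Matrix.det_transpose]
  have h2 := congrArg Matrix.det
    ((unitaryFrame g k l).toMatrix_mul_toMatrix_flip s.basis)
  rw [Matrix.det_mul, Matrix.det_one] at h2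
  exact left_ne_zero_of_mul_eq_one h2

end HolFrame

/-- An endomorphism with matrix `Θ` in the basis `s = M e` has matrix `Θ₀` in the basis `e` if
`Θ M = M Θ₀`. -/
lemma repr_constr_of_mul_eq {V ι : Type*} [AddCommGroup V] [Module ℂ V] [Fintype ι]
    (s e : Module.Basis ι ℂ V) {M Θ Θ₀ : Matrix ι ι ℂ} (hs : ∀ a, s a = ∑ b, M a b • e b)
    (h : Θ * M = M * Θ₀) (a b : ι) :
    e.repr (s.constr ℂ (fun a => ∑ b, Θ a b • s b) (e a)) b = Θ₀ a b := by
  classical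
  suffices hK : s.constr ℂ (fun a => ∑ b, Θ a b • s b) = e.constr ℂ (fun a => ∑ b, Θ₀ a b • e b) by
    rw [hK, Module.Basis.constr_basis]
    simp [Finsupp.single_apply]
  refine s.ext fun a => ?_
  have key : ∀ P Q : Matrix ι ι ℂ, ∑ b, P a b • ∑ c, Q b c • e c = ∑ c, (P * Q) a c • e c :=
    fun P Q => by
      simp only [Finset.smul_sum, Matrix.mul_apply, Finset.sum_smul, smul_smul]
      exact Finset.sum_comm
  rw [Module.Basis.constr_basis]
  conv_rhs => rw [hs a, map_sum]
  simp only [map_smul, Module.Basis.constr_basis]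
  rw [key M Θ₀, ← h, ← key Θ M]
  exact Finset.sum_congr rfl fun b _ => by rw [hs b]

lemma star_apply_of_mem_su (X : su n) (i j : Fin n) : star (X.1 i j) = -X.1 j i :=
  congrFun (congrFun X.2.1 j) i

/-- The curvature of `E_l / E_k` in the unitary frame formed by the columns of `g`. -/
theorem curvatureMatrix_eq {k l : Fin (n + 1)} (hkl : k ≤ l)
    (g : Matrix.specialUnitaryGroup (Fin n) ℂ) (s : HolFrame (ofSU g) k l) (X Y : su n)
    (a b : BlockIdx k l) : curvatureMatrix s X Y a b =
      ∑ i : Fin n with i.castSucc < k, wedge (omegaForm b i) (omegaBarForm a i) X Y -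
      ∑ j : Fin n with l ≤ j.castSucc, wedge (omegaForm j a) (omegaBarForm j b) X Y := by
  classical
  set A := chartGL (ofSU g) with hA
  set G := suToGL g with hG
  set u : Model n := pushforward g X with hu
  set v : Model n := pushforward g Y with hv
  obtain ⟨h1, h2, h3⟩ := chernCurvatureMat_tautGram A G k l hkl u v
  have h4 : chernCurvatureMat s.gramInChart 0 u v * s.transition G 0 =
      s.transition G 0 * chernCurvatureMat (tautGram A G k l) 0 u v :=
    chernCurvatureMat_gauge h1 (s.matHolAt_transition G)
      (by rw [h2, Matrix.det_one]; exact one_ne_zero) (HolFrame.det_transition_ne_zero g s)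
      (HolFrame.gramInChart_eventuallyEq g s)
  have h5 : curvatureSU s X Y =
      s.basis.constr ℂ fun a => ∑ b, chernCurvatureMat s.gramInChart 0 u v a b • s.basis b := by
    rw [curvatureSU, HolFrame.curvature, extChartAt_self]
    rfl
  have h6 : curvatureMatrix s X Y a b = chernCurvatureMat (tautGram A G k l) 0 u v a b :=
    calc curvatureMatrix s X Y a b
        = (unitaryFrame g k l).repr (curvatureSU s X Y (unitaryFrame g k l a)) b := rfl
      _ = _ := by
        rw [h5]
        exact repr_constr_of_mul_eq s.basis _ (HolFrame.basis_eq_sum g s) h4 a b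
  have hX : ∀ i j : Fin n, j < i → dMat (liftCoord A G) 0 u i j = X.1 i j := fun i j hij => by
    rw [dMat_liftCoord]
    exact conj_lowerUni_pushforward g X hij
  have hY : ∀ i j : Fin n, j < i → dMat (liftCoord A G) 0 v i j = Y.1 i j := fun i j hij => by
    rw [dMat_liftCoord]
    exact conj_lowerUni_pushforward g Y hij
  rw [h6, h3]
  congr 1
  · refine Finset.sum_congr rfl fun i hi => ?_
    have hi : i.castSucc < k := (Finset.mem_filter.1 hi).2
    have ha : i < a.1 := Fin.castSucc_lt_castSucc_iff.1 (hi.trans_le a.2.1)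
    have hb : i < b.1 := Fin.castSucc_lt_castSucc_iff.1 (hi.trans_le b.2.1)
    rw [hX _ _ hb, hX _ _ ha, hY _ _ hb, hY _ _ ha, star_apply_of_mem_su, star_apply_of_mem_su]
    simp [wedge, omegaForm, omegaBarForm]
  · refine Finset.sum_congr rfl fun j hj => ?_
    have hj : l ≤ j.castSucc := (Finset.mem_filter.1 hj).2
    have ha : a.1 < j := Fin.castSucc_lt_castSucc_iff.1 (a.2.2.trans_le hj)
    have hb : b.1 < j := Fin.castSucc_lt_castSucc_iff.1 (b.2.2.trans_le hj)
    rw [hX _ _ hb, hX _ _ ha, hY _ _ hb, hY _ _ ha, star_apply_of_mem_su, star_apply_of_mem_su]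
    simp [wedge, omegaForm, omegaBarForm]

lemma trace_curvatureSU {k l : Fin (n + 1)} (g : Matrix.specialUnitaryGroup (Fin n) ℂ)
    (s : HolFrame (ofSU g) k l) (X Y : su n) :
    LinearMap.trace ℂ _ (curvatureSU s X Y) = ∑ a, curvatureMatrix s X Y a a := by
  rw [LinearMap.trace_eq_matrix_trace ℂ (unitaryFrame g k l), Matrix.trace]
  refine Finset.sum_congr rfl fun a _ => ?_
  rw [Matrix.diag_apply, LinearMap.toMatrix_apply]
  rfl

/-- Both factors carry `γ`, so that the wedge products of the normalized forms carry `γ²`. -/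
lemma wedge_low (γ : ℂ) (i j i' j' : Fin n) (X Y : su n) :
    wedge (omegaLow γ i j) (omegaBarLow γ i' j') X Y =
      γ ^ 2 * wedge (omegaForm j i) (omegaBarForm j' i') X Y := by
  simp only [wedge, omegaLow, omegaBarLow, LinearMap.smul_apply, smul_eq_mul]
  ring

end CompleteFlag

theorem mainTheorem9 (n : ℕ) :
    -- local holomorphic frames exist everywhere
    (∀ (x : CompleteFlag n) (k l : Fin (n + 1)), k < l → Nonempty (HolFrame x k l)) ∧
    -- the curvature matrix of `E_l / E_k`
    (∀ (k l : Fin (n + 1)), k < l → ∀ (g : Matrix.specialUnitaryGroup (Fin n) ℂ)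
      (s : HolFrame (ofSU g) k l) (X Y : su n) (a b : BlockIdx k l),
      curvatureMatrix s X Y a b =
        ∑ i : Fin n with i.castSucc < k, wedge (omegaForm b i) (omegaBarForm a i) X Y -
        ∑ j : Fin n with l ≤ j.castSucc, wedge (omegaForm j a) (omegaBarForm j b) X Y) ∧
    ∀ γ : ℂ, γ ^ 2 = Complex.I / (2 * Real.pi) →
      -- the first Chern form of the line bundle `E_{k+1} / E_k` (zero-based `k`)
      (∀ (k : Fin n) (g : Matrix.specialUnitaryGroup (Fin n) ℂ)
        (s : HolFrame (ofSU g) k.castSucc k.succ) (X Y : su n),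
        firstChernSU s X Y =
          ∑ i : Fin n with i < k, Omega γ i k X Y - ∑ j : Fin n with k < j, Omega γ k j X Y) ∧
      -- the normalized curvature matrix of `E_k = E_k / E_0`
      (∀ (k : Fin (n + 1)) (g : Matrix.specialUnitaryGroup (Fin n) ℂ)
        (s : HolFrame (ofSU g) 0 k) (X Y : su n) (a b : BlockIdx 0 k),
        Complex.I / (2 * Real.pi) * curvatureMatrix s X Y a b =
          -∑ j : Fin n with k ≤ j.castSucc,
            wedge (omegaLow γ a j) (omegaBarLow γ b j) X Y) := by
  refine ⟨fun x k l _ => nonempty_holFrame x k l,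
    fun k l hkl g s X Y a b => curvatureMatrix_eq hkl.le g s X Y a b, fun γ hγ => ⟨?_, ?_⟩⟩
  · intro k g s X Y
    have huniq : ∀ a : BlockIdx k.castSucc k.succ,
        a = ⟨k, le_rfl, Fin.castSucc_lt_succ⟩ := fun a => Subtype.ext <|
      le_antisymm (Fin.castSucc_lt_succ_iff.1 a.2.2) (Fin.castSucc_le_castSucc_iff.1 a.2.1)
    rw [firstChernSU, map_smul, trace_curvatureSU,
      Fintype.sum_eq_single ⟨k, le_rfl, Fin.castSucc_lt_succ⟩ fun a ha => absurd (huniq a) ha,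
      curvatureMatrix_eq Fin.castSucc_lt_succ.le, ← hγ, smul_eq_mul, mul_sub, Finset.mul_sum,
      Finset.mul_sum]
    simp only [Omega, wedge_low, Fin.castSucc_lt_castSucc_iff, Fin.succ_le_castSucc_iff]
  · intro k g s X Y a b
    rw [curvatureMatrix_eq (Fin.zero_le k), ← hγ]
    simp [wedge_low, Finset.mul_sum]
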